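/- Let $1 < a \le b < c < d$ be integers with $c \le 2a$ and $2b \le d$, and let $k$ be a field. Let $$R = k[x^{\alpha}y^{d-\alpha} \mid \alpha \in \{0\}\cup[a,b]\cup[c,d]] \subseteq k[x,y],$$ where $[p,q]$ denotes the set of integers $\alpha$ with $p \le \alpha \le q$, graded so that the given monomial generators have degree $1$. Let $R_+ = \bigoplus_{n\ge 1} R_n$ and let $Q = (x^d, y^d)$ be the ideal of $R$ generated by $x^d$ and $y^d$. Then $R$ is a Cohen--Macaulay ring, $Q$ is a reduction of $R_+$, and $$\operatorname{reg}(R) = r_Q(R_+) = \left\lceil \frac{a-1}{d-c} \right\rceil + 1.$$ Here $Q$ being a reduction of $R_+$ means that $Q \subseteq R_+$ and $Q R_+^{\,r} = R_+^{\,r+1}$ for some $r \ge 0$, and $r_Q(R_+)$ is the least such $r$. The Castelnuovo--Mumford regularity is $\operatorname{reg}(R) = \max\{b_i - i \mid F_i \ne 0\}$, where $\cdots \to F_1 \to F_0 \to R \to 0$ is a minimal graded free resolution of $R$ over the standard graded polynomial ring $S = k[T_{\alpha} \mid \alpha \in \{0\}\cup[a,b]\cup[c,d]]$, which acts on $R$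 through $T_{\alpha} \mapsto x^{\alpha}y^{d-\alpha}$, and $b_i$ is the maximal degree of the generators of $F_i$. -/

import Mathlib

noncomputable section

/-! ### Cohen-Macaulay rings -/

/-- The depth of a local ring: the supremum of the lengths of the regular sequences contained in
its maximal ideal. -/
def localDepth (A : Type*) [CommRing A] [IsLocalRing A] : ℕ∞ :=
  ⨆ rs : {rs : List A // (∀ t ∈ rs, t ∈ IsLocalRing.maximalIdeal A) ∧
    RingTheory.Sequence.IsRegular A rs}, (rs.1.length : ℕ∞)

/-- A Noetherian ring is Cohen-Macaulay if depth and Krull dimension agree for its localization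
at every maximal ideal. -/
def IsCohenMacaulayRing (A : Type*) [CommRing A] : Prop :=
  IsNoetherianRing A ∧ ∀ (m : Ideal A) [m.IsMaximal],
    ((localDepth (Localization.AtPrime m) : ℕ∞) : WithBot ℕ∞) =
      ringKrullDim (Localization.AtPrime m)

/-! ### Reductions of ideals -/

/-- `J` is a reduction of `I`: `J ⊆ I` and `J I ^ r = I ^ (r + 1)` for some `r`. -/
def IsReduction {A : Type*} [CommRing A] (J I : Ideal A) : Prop :=
  J ≤ I ∧ ∃ r : ℕ, J * I ^ r = I ^ (r + 1)

/-- The reduction number `r_J(I)`: the least `r` with `J I ^ r = I ^ (r + 1)`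
(meaningful when `J` is a reduction of `I`). -/
def reductionNumber {A : Type*} [CommRing A] (J I : Ideal A) : ℕ :=
  sInf {r : ℕ | J * I ^ r = I ^ (r + 1)}

/-! ### Castelnuovo-Mumford regularity -/

/-- In the graded free module `⨁ j, S(-e j)` over the polynomial ring `S` (all variables of
degree one), the vector `v` is homogeneous of degree `n`. -/
def IsHomogeneousVector {k σ ι : Type*} [Field k] (e : ι → ℕ) (v : ι → MvPolynomial σ k)
    (n : ℕ) : Prop :=
  ∀ j m, (v j).coeff m ≠ 0 → m.degree + e j = n

/-- A minimal graded free resolution `⋯ → F₁ → F₀ → M → 0`, with all `F i` of finite rank, of a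
module `M` over the standard graded polynomial ring `S = k[σ]`, where `M` is graded in nonnegative
degrees with pieces `ℳ n`. Here `F i = ⨁ j, S(-deg i j)`, that is, `F i` has a basis indexed by
`Fin (rank i)` whose `j`-th element has degree `deg i j`. All maps are homogeneous of degree `0`,
and minimality means that the image of `F (i + 1)` lies in `(σ) F i`. -/
structure MinimalGradedFreeResolution {k σ M : Type*} [Field k] [AddCommGroup M] [Module k M]
    [Module (MvPolynomial σ k) M] (ℳ : ℕ → Submodule k M) where
  rank : ℕ → ℕ
  deg : ∀ i, Fin (rank i) → ℕ
  diff : ∀ i, (Fin (rank (i + 1)) → MvPolynomial σ k) →ₗ[MvPolynomial σ k]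
    (Fin (rank i) → MvPolynomial σ k)
  aug : (Fin (rank 0) → MvPolynomial σ k) →ₗ[MvPolynomial σ k] M
  diff_homogeneous : ∀ i l,
    IsHomogeneousVector (deg i) (diff i (Pi.single l 1)) (deg (i + 1) l)
  aug_homogeneous : ∀ l, aug (Pi.single l 1) ∈ ℳ (deg 0 l)
  minimal : ∀ i l j, MvPolynomial.constantCoeff (diff i (Pi.single l 1) j) = 0
  aug_surjective : Function.Surjective aug
  exact_aug : Function.Exact (diff 0) aug
  exact_diff : ∀ i, Function.Exact (diff (i + 1)) (diff i)

/-- `M` has Castelnuovo-Mumford regularity `r`: there is a minimal graded free resolution, and for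
every such resolution `r` is the maximum of `b i - i`, where `b i` is the largest degree of a basis
element of `F i` (the indices `i` with `F i = 0` do not contribute). -/
def HasRegularity {k σ M : Type*} [Field k] [AddCommGroup M] [Module k M]
    [Module (MvPolynomial σ k) M] (ℳ : ℕ → Submodule k M) (r : ℤ) : Prop :=
  Nonempty (MinimalGradedFreeResolution (σ := σ) ℳ) ∧
    ∀ F : MinimalGradedFreeResolution (σ := σ) ℳ,
      IsGreatest {z : ℤ | ∃ (i : ℕ) (j : Fin (F.rank i)), z = (F.deg i j : ℤ) - i} r

/-! ### Projective monomial curves -/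

namespace MonomialCurve

variable (k : Type*) [Field k] (d : ℕ) (Λ : Finset ℕ)

/-- The monomial `x ^ α * y ^ (d - α)` (used for `α ≤ d` only), where `x = X 0`, `y = X 1`. -/
def gen (α : ℕ) : MvPolynomial (Fin 2) k :=
  MvPolynomial.X 0 ^ α * MvPolynomial.X 1 ^ (d - α)

/-- The coordinate ring `R = k[x ^ α y ^ (d - α) : α ∈ Λ]`, a subalgebra of `k[x, y]`. -/
abbrev coordRing : Subalgebra k (MvPolynomial (Fin 2) k) :=
  Algebra.adjoin k (gen k d '' (Λ : Set ℕ))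

/-- The graded piece `R_n` of `R`, for the grading in which the generators have degree `1`: the
elements of `R` that are forms of degree `n * d` in `x, y`. -/
def piece (n : ℕ) : Submodule k (coordRing k d Λ) :=
  (MvPolynomial.homogeneousSubmodule (Fin 2) k (n * d)).comap (coordRing k d Λ).val.toLinearMap

/-- The ideal `R_+` generated by all `R_n` with `n ≥ 1`. -/
def irrelevant : Ideal (coordRing k d Λ) :=
  Ideal.span (⋃ n ∈ Set.Ici 1, (piece k d Λ n : Set (coordRing k d Λ)))

/-- The ideal `Q = (x ^ d, y ^ d)` of `R` (both monomials lie in `R` when `0, d ∈ Λ`). -/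
def Q : Ideal (coordRing k d Λ) :=
  Ideal.span {f | (f : MvPolynomial (Fin 2) k) = MvPolynomial.X 0 ^ d ∨
    (f : MvPolynomial (Fin 2) k) = MvPolynomial.X 1 ^ d}

/-- The presentation `S = k[T_α : α ∈ Λ] → R`, `T_α ↦ x ^ α y ^ (d - α)`. -/
def presentation : MvPolynomial Λ k →ₐ[k] coordRing k d Λ :=
  MvPolynomial.aeval fun α : Λ =>
    ⟨gen k d α, Algebra.subset_adjoin (Set.mem_image_of_mem _ α.2)⟩

/-- `reg R = r`, where `R` is regarded as a graded module over `S` through its presentation. -/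
def HasReg (r : ℤ) : Prop :=
  letI : Module (MvPolynomial Λ k) (coordRing k d Λ) :=
    Module.compHom (coordRing k d Λ) (presentation k d Λ).toRingHom
  HasRegularity (σ := Λ) (piece k d Λ) r

end MonomialCurve

end

/-! The hypotheses c ≤ 2a and 2b ≤ d say that two elements of [a,b] add up to an element of [c,d].
Hence the x-exponents of monomials of R form the union of the intervals [jc, jd] and [a+jc, b+jd],
and every such exponent p ≤ nd is a sum of n elements of Λ (`IsTwoBlock.exists_sub`). So x^p y^q
lies in R exactly when p is in this semigroup and d divides p+q; there is no further condition on q.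

Consequently a monomial of R with q ≥ d is divisible by y^d in R. This makes nonzero f(x^d), g(y^d)
a regular sequence on R (`IsTwoBlock.exists_eq_mul_of_mul_eq`). Every maximal ideal contains such a
pair, and R is integral over k modulo it, so R is Cohen-Macaulay.

The quotient R/Q is spanned by the monomials with q < d and p-d outside the semigroup. In degree
n+1, q < d means p > nd. Let K+1 be the ceiling of (a-1)/(d-c). From degree K+3 on the relevant
intervals leave no gap, so R/Q vanishes (`IsTwoBlock.isExponent_sub`), while x^((K+1)d+1) y^(d-1)
survives in degree K+2. As R_+^n consists of the elements all of whose monomials have degree at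
least n, the reduction number is the top degree K+2 of R/Q.

For the regularity, a minimal resolution F is reduced modulo x^d, y^d and then modulo the other
variables one at a time. Each variable shifts homological and internal degree together by at most
one, which bounds the degrees of F_i by r+i, with r the top degree of R/Q
(`MinimalGradedFreeResolution.deg_le`). Following a top-degree socle element of R/Q through the
connecting maps shows that the bound is attained
(`MinimalGradedFreeResolution.exists_sub_diff_mem_of_socle`). -/

open MvPolynomial

/-! ### Graded free modules and their reductions modulo sets of variables. -/

section GradedVectors

variable {k σ ι κ : Type*} [Field k]

/-- The homogeneous component of degree `n` of a vector in the graded free module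
`⨁ j, S(-e j)`. -/
noncomputable def vectorComponent (e : ι → ℕ) (n : ℕ) :
    (ι → MvPolynomial σ k) →ₗ[k] (ι → MvPolynomial σ k) :=
  LinearMap.pi fun j =>
    -- Without the guard, truncated subtraction would return the constant term when n < e j.
    (if e j ≤ n then homogeneousComponent (n - e j) else 0) ∘ₗ LinearMap.proj j

lemma coeff_vectorComponent (e : ι → ℕ) (n : ℕ) (v : ι → MvPolynomial σ k) (j : ι) (m : σ →₀ ℕ) :
    (vectorComponent e n v j).coeff m = if m.degree + e j = n then (v j).coeff m else 0 := by
  simp only [vectorComponent, LinearMap.pi_apply, LinearMap.comp_apply, LinearMap.proj_apply]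
  split_ifs with h1 h2 h2
  · rw [coeff_homogeneousComponent, if_pos (by omega)]
  · rw [coeff_homogeneousComponent, if_neg (by omega)]
  · omega
  · simp

lemma isHomogeneousVector_vectorComponent (e : ι → ℕ) (n : ℕ) (v : ι → MvPolynomial σ k) :
    IsHomogeneousVector e (vectorComponent e n v) n := by
  intro j m h
  rw [coeff_vectorComponent] at h
  by_contra h'
  exact h (if_neg h')

lemma IsHomogeneousVector.vectorComponent_eq {e : ι → ℕ} {n : ℕ} {v : ι → MvPolynomial σ k}
    (h : IsHomogeneousVector e v n) : vectorComponent e n v = v := by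
  funext j
  ext m
  rw [coeff_vectorComponent]
  split_ifs with h1
  · rfl
  · by_contra h2
    exact h1 (h j m (Ne.symm h2))

lemma isHomogeneousVector_iff {e : ι → ℕ} {n : ℕ} {v : ι → MvPolynomial σ k} :
    IsHomogeneousVector e v n ↔ vectorComponent e n v = v :=
  ⟨IsHomogeneousVector.vectorComponent_eq,
    fun h => h ▸ isHomogeneousVector_vectorComponent e n v⟩

lemma IsHomogeneousVector.vectorComponent_eq_zero {e : ι → ℕ} {n i : ℕ}
    {v : ι → MvPolynomial σ k} (h : IsHomogeneousVector e v n) (hi : i ≠ n) :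
    vectorComponent e i v = 0 := by
  funext j
  ext m
  rw [coeff_vectorComponent]
  split_ifs with h1
  · by_contra h2
    exact hi (h1 ▸ h j m h2)
  · simp

lemma isHomogeneousVector_single [DecidableEq ι] (e : ι → ℕ) (l : ι) :
    IsHomogeneousVector e (Pi.single l (1 : MvPolynomial σ k)) (e l) := by
  classical
  intro j m h
  by_cases hj : j = l
  · subst hj
    rw [Pi.single_eq_same, coeff_one] at h
    have : m = 0 := by
      by_contra h'
      exact h (if_neg (Ne.symm h'))
    simp [this]
  · simp [Pi.single_eq_of_ne hj] at h

lemma vectorComponent_X_smul (e : ι → ℕ) (n : ℕ) (t : σ) (v : ι → MvPolynomial σ k) :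
    vectorComponent e (n + 1) ((X t : MvPolynomial σ k) • v) =
      (X t : MvPolynomial σ k) • vectorComponent e n v := by
  classical
  funext j
  ext m
  rw [coeff_vectorComponent, Pi.smul_apply, Pi.smul_apply, smul_eq_mul, smul_eq_mul, coeff_X_mul',
    coeff_X_mul', coeff_vectorComponent]
  by_cases hm : t ∈ m.support
  · have h1 : m = (m - Finsupp.single t 1) + Finsupp.single t 1 := by
      rw [tsub_add_cancel_of_le]
      rw [Finsupp.single_le_iff]
      have := Finsupp.mem_support_iff.1 hm
      omega
    have h2 : m.degree = (m - Finsupp.single t 1).degree + 1 := by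
      conv_lhs => rw [h1]
      simp
    simp only [hm, if_true]
    exact if_congr (by omega) rfl rfl
  · simp [hm]

lemma IsHomogeneousVector.X_smul {e : ι → ℕ} {n : ℕ} {v : ι → MvPolynomial σ k}
    (h : IsHomogeneousVector e v n) (t : σ) :
    IsHomogeneousVector e ((X t : MvPolynomial σ k) • v) (n + 1) := by
  rw [isHomogeneousVector_iff, vectorComponent_X_smul, h.vectorComponent_eq]

lemma exists_forall_sum_vectorComponent [Fintype ι] (e : ι → ℕ) (v : ι → MvPolynomial σ k) :
    ∃ N, ∀ N' ≥ N, ∑ n ∈ Finset.range N', vectorComponent e n v = v := by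
  refine ⟨Finset.univ.sup (fun j => (v j).totalDegree + e j) + 1, fun N' hN => ?_⟩
  funext j
  ext m
  rw [Finset.sum_apply, coeff_sum]
  simp_rw [coeff_vectorComponent]
  rw [Finset.sum_ite_eq]
  split_ifs with h
  · rfl
  · by_contra h'
    have h1 : m.degree ≤ (v j).totalDegree := by
      have := le_totalDegree (mem_support_iff.2 (Ne.symm h'))
      rwa [Finsupp.degree_apply]
    have h2 : (v j).totalDegree + e j ≤ Finset.univ.sup (fun j => (v j).totalDegree + e j) :=
      Finset.le_sup (f := fun j => (v j).totalDegree + e j) (Finset.mem_univ j)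
    rw [Finset.mem_range] at h
    omega

/-- A family of homogeneous pieces of an `S`-module that is compatible with the standard grading
of `S = k[σ]` and independent. -/
structure IsIndepGrading {M : Type*} [AddCommGroup M] [Module k M] [Module (MvPolynomial σ k) M]
    (ℳ : ℕ → Submodule k M) : Prop where
  smul_mem : ∀ {m n : ℕ} {f : MvPolynomial σ k} {x : M}, f.IsHomogeneous m → x ∈ ℳ n →
    f • x ∈ ℳ (m + n)
  eq_zero : ∀ (s : Finset ℕ) (x : ℕ → M), (∀ n, x n ∈ ℳ n) → ∑ n ∈ s, x n = 0 → ∀ n ∈ s, x n = 0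

/-- The homogeneous vectors of degree `n` in `⨁ j, S(-e j)`. -/
def homogeneousVectors (e : ι → ℕ) (n : ℕ) : Submodule k (ι → MvPolynomial σ k) where
  carrier := {v | IsHomogeneousVector e v n}
  add_mem' := by
    intro v w hv hw
    simp only [Set.mem_ofPred_eq, isHomogeneousVector_iff] at *
    rw [map_add, hv, hw]
  zero_mem' := by simp [isHomogeneousVector_iff]
  smul_mem' := by
    intro c v hv
    simp only [Set.mem_ofPred_eq, isHomogeneousVector_iff] at *
    rw [map_smul, hv]

lemma isIndepGrading_homogeneousVectors (e : ι → ℕ) :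
    IsIndepGrading (σ := σ) (homogeneousVectors (k := k) (σ := σ) e) where
  smul_mem := by
    classical
    intro m n f v hf hv j c hc
    rw [Pi.smul_apply, smul_eq_mul, coeff_mul] at hc
    obtain ⟨⟨p, q⟩, hpq, hne⟩ := Finset.exists_ne_zero_of_sum_ne_zero hc
    rw [Finset.HasAntidiagonal.mem_antidiagonal] at hpq
    have h1 : p.degree = m := by
      by_contra h
      exact hne (by rw [hf.coeff_eq_zero h, zero_mul])
    have h2 := hv j q (right_ne_zero_of_mul hne)
    rw [← hpq, map_add]
    simp only at *
    omega
  eq_zero := by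
    intro s x hx hs n hn
    have h := congrArg (vectorComponent e n) hs
    rw [map_sum, map_zero, Finset.sum_eq_single_of_mem n hn] at h
    · rwa [(hx n).vectorComponent_eq] at h
    · intro i _ hi
      exact (hx i).vectorComponent_eq_zero (Ne.symm hi)

variable {M : Type*} [AddCommGroup M] [Module k M] [Module (MvPolynomial σ k) M]
  {ℳ : ℕ → Submodule k M}

lemma IsIndepGrading.map_mem [Fintype ι] [DecidableEq ι] (hℳ : IsIndepGrading (σ := σ) ℳ)
    {e : ι → ℕ} {φ : (ι → MvPolynomial σ k) →ₗ[MvPolynomial σ k] M}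
    (hφ : ∀ l, φ (Pi.single l 1) ∈ ℳ (e l)) {v : ι → MvPolynomial σ k} {n : ℕ}
    (hv : IsHomogeneousVector e v n) : φ v ∈ ℳ n := by
  rw [pi_eq_sum_univ' v, map_sum]
  refine Submodule.sum_mem _ fun j _ => ?_
  rw [map_smul]
  by_cases h0 : v j = 0
  · rw [h0, zero_smul]
    exact Submodule.zero_mem _
  · obtain ⟨m, hm⟩ := exists_coeff_ne_zero h0
    have h2 := hv j m hm
    rw [← h2]
    refine hℳ.smul_mem ?_ (hφ j)
    intro m' hm'
    have h3 := hv j m' hm'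
    have h4 : m'.degree = m.degree := by omega
    rw [← h4]
    simp [Finsupp.weight_apply, Finsupp.degree_apply, Finsupp.sum]

lemma IsIndepGrading.map_vectorComponent_eq [Fintype ι] [DecidableEq ι]
    (hℳ : IsIndepGrading (σ := σ) ℳ)
    {e : ι → ℕ} {φ : (ι → MvPolynomial σ k) →ₗ[MvPolynomial σ k] M}
    (hφ : ∀ l, φ (Pi.single l 1) ∈ ℳ (e l)) {v : ι → MvPolynomial σ k} {n : ℕ}
    (hv : φ v ∈ ℳ n) : φ (vectorComponent e n v) = φ v := by
  obtain ⟨N, hN⟩ := exists_forall_sum_vectorComponent e v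
  -- The range is enlarged so that it also contains n.
  have h1 := hN (N + n + 1) (by omega)
  have h2 := hℳ.eq_zero (Finset.range (N + n + 1))
    (fun i => φ (vectorComponent e i v) - if i = n then φ v else 0) (by
      intro i
      refine Submodule.sub_mem _
        (hℳ.map_mem hφ (isHomogeneousVector_vectorComponent e i v)) ?_
      split_ifs with h
      · rwa [h]
      · exact Submodule.zero_mem _) (by
      rw [Finset.sum_sub_distrib, ← map_sum, h1, Finset.sum_ite_eq', if_pos (by simp),
        sub_self]) n (by simp)
  simpa [sub_eq_zero] using h2

lemma map_vectorComponent [Fintype ι] [DecidableEq ι] {e : ι → ℕ} {e' : κ → ℕ}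
    {φ : (ι → MvPolynomial σ k) →ₗ[MvPolynomial σ k] (κ → MvPolynomial σ k)}
    (hφ : ∀ l, IsHomogeneousVector e' (φ (Pi.single l 1)) (e l)) (v : ι → MvPolynomial σ k)
    (n : ℕ) : φ (vectorComponent e n v) = vectorComponent e' n (φ v) := by
  obtain ⟨N, hN⟩ := exists_forall_sum_vectorComponent e v
  have h1 := hN (N + n + 1) (by omega)
  have hh : ∀ i, IsHomogeneousVector e' (φ (vectorComponent e i v)) i := fun i =>
    (isIndepGrading_homogeneousVectors e').map_mem hφ (isHomogeneousVector_vectorComponent e i v)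
  conv_rhs => rw [← h1, map_sum, map_sum]
  rw [Finset.sum_eq_single_of_mem n (by simp), (hh n).vectorComponent_eq]
  intro i _ hi
  exact (hh i).vectorComponent_eq_zero (Ne.symm hi)

/-- The vectors all of whose coordinates lie in the ideal generated by the variables in `J`. -/
noncomputable def vectorIdeal (k ι : Type*) [Field k] (J : Set σ) :
    Submodule (MvPolynomial σ k) (ι → MvPolynomial σ k) :=
  Submodule.pi Set.univ fun _ => Ideal.span (X '' J)

lemma mem_vectorIdeal {J : Set σ} {v : ι → MvPolynomial σ k} :
    v ∈ vectorIdeal k ι J ↔ ∀ j, v j ∈ Ideal.span (X '' J) := by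
  simp [vectorIdeal, Submodule.mem_pi]

lemma mem_vectorIdeal_iff_coeff {J : Set σ} {v : ι → MvPolynomial σ k} :
    v ∈ vectorIdeal k ι J ↔ ∀ j m, (v j).coeff m ≠ 0 → ∃ t ∈ J, m t ≠ 0 := by
  simp [mem_vectorIdeal, mem_ideal_span_X_image]

lemma map_mem_vectorIdeal [Fintype ι] [DecidableEq ι] {J : Set σ}
    (φ : (ι → MvPolynomial σ k) →ₗ[MvPolynomial σ k] (κ → MvPolynomial σ k))
    {v : ι → MvPolynomial σ k} (hv : v ∈ vectorIdeal k ι J) : φ v ∈ vectorIdeal k κ J := by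
  rw [mem_vectorIdeal] at *
  intro l
  rw [pi_eq_sum_univ' v, map_sum, Finset.sum_apply]
  refine Ideal.sum_mem _ fun j _ => ?_
  rw [map_smul, Pi.smul_apply, smul_eq_mul]
  exact Ideal.mul_mem_right _ _ (hv j)

lemma vectorIdeal_mono {J J' : Set σ} (h : J ⊆ J') : vectorIdeal k ι J ≤ vectorIdeal k ι J' := by
  intro v
  simp only [mem_vectorIdeal]
  exact fun hv j => Ideal.span_mono (Set.image_mono h) (hv j)

lemma X_smul_mem_vectorIdeal {J : Set σ} {t : σ} (ht : t ∈ J) (v : ι → MvPolynomial σ k) :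
    (X t : MvPolynomial σ k) • v ∈ vectorIdeal k ι J := by
  rw [mem_vectorIdeal]
  intro j
  exact Ideal.mul_mem_right _ _ (Ideal.subset_span (Set.mem_image_of_mem _ ht))

lemma exists_sub_X_smul_mem_vectorIdeal {J : Set σ} {t : σ} {v : ι → MvPolynomial σ k}
    (hv : v ∈ vectorIdeal k ι (insert t J)) :
    ∃ w, v - (X t : MvPolynomial σ k) • w ∈ vectorIdeal k ι J := by
  rw [mem_vectorIdeal, Set.image_insert_eq] at hv
  have h : ∀ j, ∃ w, v j - X t * w ∈ Ideal.span (X '' J) := by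
    intro j
    obtain ⟨w, z, hz, h⟩ := Ideal.mem_span_insert.1 (hv j)
    refine ⟨w, ?_⟩
    rw [h, mul_comm, add_sub_cancel_left]
    exact hz
  choose w hw using h
  exact ⟨w, mem_vectorIdeal.2 hw⟩

lemma mem_vectorIdeal_of_X_smul {J : Set σ} {t : σ} (ht : t ∉ J) {v : ι → MvPolynomial σ k}
    (hv : (X t : MvPolynomial σ k) • v ∈ vectorIdeal k ι J) : v ∈ vectorIdeal k ι J := by
  rw [mem_vectorIdeal_iff_coeff] at *
  intro j m hm
  obtain ⟨s, hs, h⟩ := hv j (Finsupp.single t 1 + m) (by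
    rw [Pi.smul_apply, smul_eq_mul, coeff_X_mul]; exact hm)
  refine ⟨s, hs, ?_⟩
  rwa [Finsupp.add_apply, Finsupp.single_eq_of_ne (by rintro rfl; exact ht hs), zero_add] at h

lemma vectorComponent_mem_vectorIdeal {J : Set σ} {v : ι → MvPolynomial σ k} (e : ι → ℕ) (n : ℕ)
    (hv : v ∈ vectorIdeal k ι J) : vectorComponent e n v ∈ vectorIdeal k ι J := by
  rw [mem_vectorIdeal_iff_coeff] at *
  intro j m hm
  rw [coeff_vectorComponent] at hm
  exact hv j m (fun h => hm (by simp [h]))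

lemma IsHomogeneousVector.mem_vectorIdeal_univ {e : ι → ℕ} {n : ℕ} {v : ι → MvPolynomial σ k}
    (hv : IsHomogeneousVector e v n) (h : ∀ j, e j < n) : v ∈ vectorIdeal k ι Set.univ := by
  rw [mem_vectorIdeal_iff_coeff]
  intro j m hm
  by_contra! h'
  have h0 : m = 0 := Finsupp.ext fun t => h' t (Set.mem_univ t)
  have := hv j m hm
  have := h j
  simp [h0] at *
  omega

lemma mem_vectorIdeal_univ_iff {v : ι → MvPolynomial σ k} :
    v ∈ vectorIdeal k ι Set.univ ↔ ∀ j, constantCoeff (v j) = 0 := by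
  rw [mem_vectorIdeal_iff_coeff]
  constructor
  · intro h j
    by_contra h0
    obtain ⟨t, _, ht⟩ := h j 0 h0
    exact ht rfl
  · intro h j m hm
    by_contra! h'
    have h0 : m = 0 := Finsupp.ext fun t => h' t (Set.mem_univ t)
    rw [h0] at hm
    exact hm (h j)

end GradedVectors

/-! ### Existence of minimal graded free resolutions. -/

section MinimalResolution

variable {k σ : Type*} [Field k]

/-- A generating set of least cardinality works. A relation with nonzero constant term at j can be
replaced by its component of degree e j, whose j-th coefficient is a nonzero scalar; then the j-th
generator is redundant. -/
lemma exists_minimal_generators {P : Type*} [AddCommGroup P] [Module k P]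
    [Module (MvPolynomial σ k) P] {ℳ : ℕ → Submodule k P} (hℳ : IsIndepGrading (σ := σ) ℳ)
    (N : Submodule (MvPolynomial σ k) P)
    (hN : ∃ s : Finset P, (∀ x ∈ s, ∃ n, x ∈ ℳ n) ∧
      Submodule.span (MvPolynomial σ k) (s : Set P) = N) :
    ∃ (m : ℕ) (e : Fin m → ℕ) (φ : (Fin m → MvPolynomial σ k) →ₗ[MvPolynomial σ k] P),
      (∀ l, φ (Pi.single l 1) ∈ ℳ (e l)) ∧ LinearMap.range φ = N ∧
      ∀ v, φ v = 0 → ∀ j, constantCoeff (v j) = 0 := by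
  classical
  have hex : ∃ m : ℕ, ∃ x : Fin m → P, (∀ i, ∃ n, x i ∈ ℳ n) ∧
      Submodule.span (MvPolynomial σ k) (Set.range x) = N := by
    obtain ⟨s, hs, hspan⟩ := hN
    refine ⟨s.card, fun i => s.equivFin.symm i, fun i => hs _ (s.equivFin.symm i).2, ?_⟩
    rw [← hspan]
    congr 1
    ext y
    constructor
    · rintro ⟨i, rfl⟩
      exact (s.equivFin.symm i).2
    · intro hy
      exact ⟨s.equivFin ⟨y, hy⟩, by simp⟩
  obtain ⟨x, hx, hspan⟩ := Nat.find_spec hex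
  have hmin := fun m' (h : m' < Nat.find hex) => Nat.find_min hex h
  generalize Nat.find hex = m at x hx hspan hmin
  choose e he using hx
  have hφ : ∀ l, Fintype.linearCombination (MvPolynomial σ k) x (Pi.single l 1) = x l := by
    intro l
    rw [Fintype.linearCombination_apply_single, one_smul]
  have hφ' : ∀ l, Fintype.linearCombination (MvPolynomial σ k) x (Pi.single l 1) ∈ ℳ (e l) := by
    intro l
    rw [hφ]
    exact he l
  refine ⟨m, e, Fintype.linearCombination (MvPolynomial σ k) x, hφ', ?_, ?_⟩
  · rw [Fintype.range_linearCombination, hspan]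
  · intro v hv j
    by_contra hc
    have hw : Fintype.linearCombination (MvPolynomial σ k) x (vectorComponent e (e j) v) = 0 := by
      rw [hℳ.map_vectorComponent_eq hφ' (by rw [hv]; exact Submodule.zero_mem _), hv]
    have hwj : vectorComponent e (e j) v j = C (constantCoeff (v j)) := by
      ext m
      rw [coeff_vectorComponent, coeff_C]
      by_cases hm : m = 0
      · subst hm
        simp [constantCoeff_eq]
      · rw [if_neg, if_neg (Ne.symm hm)]
        intro h
        exact hm ((Finsupp.degree_eq_zero_iff m).1 (by omega))
    obtain ⟨m', rfl⟩ : ∃ m', m = m' + 1 := ⟨m - 1, by have := j.2; omega⟩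
    refine hmin m' (by omega) ⟨x ∘ j.succAbove, fun i => ⟨_, he _⟩, ?_⟩
    rw [← hspan]
    refine le_antisymm (Submodule.span_mono (Set.range_comp_subset_range _ _)) ?_
    rw [Submodule.span_le]
    have hothers : ∀ i, x (j.succAbove i) ∈
        Submodule.span (MvPolynomial σ k) (Set.range (x ∘ j.succAbove)) := fun i =>
      Submodule.subset_span ⟨i, rfl⟩
    rintro _ ⟨i, rfl⟩
    by_cases hij : i = j
    · subst hij
      rw [Fintype.linearCombination_apply, Fin.sum_univ_succAbove _ i, hwj,
        add_eq_zero_iff_eq_neg] at hw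
      have h1 : x i = (C (constantCoeff (v i))⁻¹ : MvPolynomial σ k) •
          (C (constantCoeff (v i)) : MvPolynomial σ k) • x i := by
        rw [smul_smul, ← C_mul, inv_mul_cancel₀ hc, C_1, one_smul]
      rw [SetLike.mem_coe, h1, hw]
      exact Submodule.smul_mem _ _ (Submodule.neg_mem _ (Submodule.sum_mem _ fun l _ =>
        Submodule.smul_mem _ _ (hothers l)))
    · obtain ⟨l, rfl⟩ := Fin.exists_succAbove_eq hij
      exact hothers l

/-- The kernel of a graded map contains the components of its elements, so the components of a
finite generating set generate it. -/
lemma exists_homogeneous_generators_ker [Finite σ] {P : Type*} [AddCommGroup P] [Module k P]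
    [Module (MvPolynomial σ k) P] {ℳ : ℕ → Submodule k P} (hℳ : IsIndepGrading (σ := σ) ℳ)
    {m : ℕ} {e : Fin m → ℕ} {φ : (Fin m → MvPolynomial σ k) →ₗ[MvPolynomial σ k] P}
    (hφ : ∀ l, φ (Pi.single l 1) ∈ ℳ (e l)) :
    ∃ s : Finset (Fin m → MvPolynomial σ k), (∀ x ∈ s, ∃ n, x ∈ homogeneousVectors e n) ∧
      Submodule.span (MvPolynomial σ k) (s : Set (Fin m → MvPolynomial σ k)) =
        LinearMap.ker φ := by
  classical
  obtain ⟨s, hs⟩ := IsNoetherian.noetherian (LinearMap.ker φ)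
  have hsφ : ∀ x ∈ s, φ x = 0 := fun x hx => by
    rw [← LinearMap.mem_ker, ← hs]
    exact Submodule.subset_span hx
  choose N hN using fun v => exists_forall_sum_vectorComponent (k := k) (σ := σ) e v
  refine ⟨s.biUnion fun x => (Finset.range (N x)).image fun n => vectorComponent e n x, ?_, ?_⟩
  · intro y hy
    simp only [Finset.mem_biUnion, Finset.mem_image] at hy
    obtain ⟨x, _, n, _, rfl⟩ := hy
    exact ⟨n, isHomogeneousVector_vectorComponent e n x⟩
  · refine le_antisymm ?_ ?_
    · rw [Submodule.span_le]
      intro y hy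
      simp only [Finset.coe_biUnion, Finset.coe_image, Set.mem_iUnion, Set.mem_image] at hy
      obtain ⟨x, hx, n, _, rfl⟩ := hy
      rw [SetLike.mem_coe, LinearMap.mem_ker, hℳ.map_vectorComponent_eq hφ, hsφ x hx]
      rw [hsφ x hx]
      exact Submodule.zero_mem _
    · rw [← hs, Submodule.span_le]
      intro x hx
      rw [SetLike.mem_coe, ← hN x (N x) le_rfl]
      refine Submodule.sum_mem _ fun n hn => Submodule.subset_span ?_
      simp only [Finset.coe_biUnion, Finset.coe_image, Set.mem_iUnion, Set.mem_image]
      exact ⟨x, hx, n, hn, rfl⟩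

/-- A homogeneous submodule of a graded free module, contained in the multiple of the module by
the ideal of all variables. -/
structure HomogeneousSyzygy (k σ : Type*) [Field k] where
  rank : ℕ
  deg : Fin rank → ℕ
  submodule : Submodule (MvPolynomial σ k) (Fin rank → MvPolynomial σ k)
  generated : ∃ s : Finset (Fin rank → MvPolynomial σ k),
    (∀ x ∈ s, ∃ n, x ∈ homogeneousVectors deg n) ∧
      Submodule.span (MvPolynomial σ k) (s : Set (Fin rank → MvPolynomial σ k)) = submodule
  minimal : ∀ v ∈ submodule, ∀ j, constantCoeff (v j) = 0

lemma HomogeneousSyzygy.exists_next [Finite σ] (Z : HomogeneousSyzygy k σ) :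
    ∃ (Y : HomogeneousSyzygy k σ)
      (φ : (Fin Y.rank → MvPolynomial σ k) →ₗ[MvPolynomial σ k]
        (Fin Z.rank → MvPolynomial σ k)),
      (∀ l, IsHomogeneousVector Z.deg (φ (Pi.single l 1)) (Y.deg l)) ∧
      LinearMap.range φ = Z.submodule ∧ Y.submodule = LinearMap.ker φ := by
  obtain ⟨m, e, φ, h1, h2, h3⟩ :=
    exists_minimal_generators (isIndepGrading_homogeneousVectors Z.deg) Z.submodule Z.generated
  exact ⟨⟨m, e, LinearMap.ker φ,
    exists_homogeneous_generators_ker (isIndepGrading_homogeneousVectors Z.deg) h1,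
    fun v hv => h3 v hv⟩, φ, h1, h2, rfl⟩

/-- Minimal covers of successive syzygies are iterated. Ranks may be zero, so termination of the
process is irrelevant. -/
theorem nonempty_minimalGradedFreeResolution [Finite σ] {M : Type*} [AddCommGroup M] [Module k M]
    [Module (MvPolynomial σ k) M] {ℳ : ℕ → Submodule k M} (hℳ : IsIndepGrading (σ := σ) ℳ)
    (hgen : ∃ s : Finset M, (∀ x ∈ s, ∃ n, x ∈ ℳ n) ∧
      Submodule.span (MvPolynomial σ k) (s : Set M) = ⊤) :
    Nonempty (MinimalGradedFreeResolution (σ := σ) ℳ) := by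
  obtain ⟨m, e, φ, h1, h2, h3⟩ := exists_minimal_generators hℳ ⊤ hgen
  choose next d hd hrange hker using fun Z : HomogeneousSyzygy k σ => Z.exists_next
  let Z : ℕ → HomogeneousSyzygy k σ := fun i =>
    Nat.rec ⟨m, e, LinearMap.ker φ, exists_homogeneous_generators_ker hℳ h1, fun v hv => h3 v hv⟩
      (fun _ Y => next Y) i
  refine ⟨{
    rank := fun i => (Z i).rank
    deg := fun i => (Z i).deg
    diff := fun i => d (Z i)
    aug := φ
    diff_homogeneous := fun i => hd (Z i)
    aug_homogeneous := h1
    minimal := fun i l => (Z i).minimal _ (by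
      rw [← hrange]
      exact LinearMap.mem_range_self _ _)
    aug_surjective := LinearMap.range_eq_top.1 h2
    exact_aug := LinearMap.exact_iff.2 (hrange (Z 0)).symm
    exact_diff := fun i => LinearMap.exact_iff.2 ?_ }⟩
  exact (hker (Z i)).symm.trans (hrange (Z (i + 1))).symm

end MinimalResolution

/-! ### Degrees in a minimal resolution, read off from its reductions modulo variables. -/

namespace MinimalGradedFreeResolution

variable {k σ M : Type*} [Field k] [AddCommGroup M] [Module k M] [Module (MvPolynomial σ k) M]
  {ℳ : ℕ → Submodule k M} (F : MinimalGradedFreeResolution (σ := σ) ℳ)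

/-- Exactness, in homological degrees above `p`, of the reduction of the resolution modulo the
variables in `J`. -/
def ExactModulo (J : Set σ) (p : ℕ) : Prop :=
  ∀ i ≥ p, ∀ v, F.diff i v ∈ vectorIdeal k _ J → ∃ z, v - F.diff (i + 1) z ∈ vectorIdeal k _ J

variable {F}

lemma diff_diff (i : ℕ) (v : Fin (F.rank (i + 1 + 1)) → MvPolynomial σ k) :
    F.diff i (F.diff (i + 1) v) = 0 :=
  (F.exact_diff i _).2 ⟨v, rfl⟩

lemma exactModulo_empty : F.ExactModulo ∅ 0 := by
  intro i _ v hv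
  have h0 : ∀ {ι : Type} (w : ι → MvPolynomial σ k), w ∈ vectorIdeal k ι (∅ : Set σ) ↔ w = 0 := by
    intro ι w
    simp [mem_vectorIdeal, funext_iff]
  rw [h0] at hv
  obtain ⟨z, hz⟩ := (F.exact_diff i v).1 hv
  exact ⟨z, by rw [hz, sub_self]; exact Submodule.zero_mem _⟩

lemma diff_sub_mem {J : Set σ} {t : σ} {i : ℕ} {v : Fin (F.rank (i + 1)) → MvPolynomial σ k}
    {w : Fin (F.rank i) → MvPolynomial σ k}
    {z : Fin (F.rank (i + 1)) → MvPolynomial σ k}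
    (hw : F.diff i v - (X t : MvPolynomial σ k) • w ∈ vectorIdeal k _ J)
    (hz : w - F.diff i z ∈ vectorIdeal k _ J) :
    F.diff i (v - (X t : MvPolynomial σ k) • z) ∈ vectorIdeal k _ J := by
  have := Submodule.add_mem _ hw (Submodule.smul_mem _ (X t : MvPolynomial σ k) hz)
  convert this using 1
  rw [map_sub, map_smul, smul_sub]
  abel

lemma ExactModulo.lift {J : Set σ} {p i : ℕ} (h : F.ExactModulo J p) (hi : p ≤ i) {t : σ}
    {v : Fin (F.rank (i + 1)) → MvPolynomial σ k} {w : Fin (F.rank i) → MvPolynomial σ k}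
    {z : Fin (F.rank (i + 1)) → MvPolynomial σ k}
    (hw : F.diff i v - (X t : MvPolynomial σ k) • w ∈ vectorIdeal k _ J)
    (hz : w - F.diff i z ∈ vectorIdeal k _ J) :
    ∃ y, v - F.diff (i + 1) y ∈ vectorIdeal k _ (insert t J) := by
  obtain ⟨y, hy⟩ := h i hi _ (diff_sub_mem hw hz)
  refine ⟨y, ?_⟩
  have := Submodule.add_mem _ (vectorIdeal_mono (Set.subset_insert t J) hy)
    (X_smul_mem_vectorIdeal (Set.mem_insert t J) z)
  convert this using 1
  abel

lemma diff_mem_of_sub_X_smul {J : Set σ} {t : σ} (ht : t ∉ J) {i : ℕ}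
    {v : Fin (F.rank (i + 1 + 1)) → MvPolynomial σ k}
    {w : Fin (F.rank (i + 1)) → MvPolynomial σ k}
    (hw : F.diff (i + 1) v - (X t : MvPolynomial σ k) • w ∈ vectorIdeal k _ J) :
    F.diff i w ∈ vectorIdeal k _ J := by
  refine mem_vectorIdeal_of_X_smul ht ?_
  have := map_mem_vectorIdeal (F.diff i) hw
  rw [map_sub, diff_diff, zero_sub, map_smul] at this
  exact (Submodule.neg_mem_iff _).1 this

/-- This is the long exact sequence of multiplication by X t on F modulo J: homology modulo `insert
t J` in degree i+1 lies between that modulo J in degrees i+1 and i. Hence one degree of exactness is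
lost. -/
lemma ExactModulo.insert_succ {J : Set σ} {p : ℕ} (h : F.ExactModulo J p) {t : σ} (ht : t ∉ J) :
    F.ExactModulo (insert t J) (p + 1) := by
  intro i hi v hv
  obtain ⟨i, rfl⟩ : ∃ i', i = i' + 1 := ⟨i - 1, by omega⟩
  obtain ⟨w, hw⟩ := exists_sub_X_smul_mem_vectorIdeal hv
  obtain ⟨z, hz⟩ := h i (by omega) w (diff_mem_of_sub_X_smul ht hw)
  exact h.lift (by omega) hw hz

/-- No exactness is lost when X t is regular on the zeroth homology modulo J, which is what `hreg`
says. -/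
lemma ExactModulo.insert_zero {J : Set σ} (h : F.ExactModulo J 0) {t : σ} (ht : t ∉ J)
    (hreg : ∀ w : Fin (F.rank 0) → MvPolynomial σ k,
      (∃ v, F.diff 0 v - (X t : MvPolynomial σ k) • w ∈ vectorIdeal k _ J) →
      ∃ z, w - F.diff 0 z ∈ vectorIdeal k _ J) :
    F.ExactModulo (insert t J) 0 := by
  intro i _ v hv
  obtain _ | i := i
  · obtain ⟨w, hw⟩ := exists_sub_X_smul_mem_vectorIdeal hv
    obtain ⟨z, hz⟩ := hreg w ⟨v, hw⟩
    exact h.lift le_rfl hw hz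
  · exact h.insert_succ ht (i + 1) (by omega) v hv

lemma aug_eq_zero_iff {w : Fin (F.rank 0) → MvPolynomial σ k} :
    F.aug w = 0 ↔ ∃ z, F.diff 0 z = w := F.exact_aug w

lemma exactModulo_pair {s t : σ} (hst : s ≠ t)
    (hs : ∀ x : M, (X s : MvPolynomial σ k) • x = 0 → x = 0)
    (ht : ∀ x y : M, (X t : MvPolynomial σ k) • x = (X s : MvPolynomial σ k) • y →
      ∃ z, x = (X s : MvPolynomial σ k) • z) :
    F.ExactModulo {t, s} 0 := by
  have h0 : ∀ {ι : Type} (w : ι → MvPolynomial σ k), w ∈ vectorIdeal k ι (∅ : Set σ) ↔ w = 0 := by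
    intro ι w
    simp [mem_vectorIdeal, funext_iff]
  have h1 : F.ExactModulo {s} 0 := by
    rw [← insert_empty_eq]
    refine exactModulo_empty.insert_zero (by simp) ?_
    rintro w ⟨v, hv⟩
    rw [h0, sub_eq_zero] at hv
    have h2 : F.aug ((X s : MvPolynomial σ k) • w) = 0 := aug_eq_zero_iff.2 ⟨v, hv⟩
    rw [map_smul] at h2
    obtain ⟨z, hz⟩ := aug_eq_zero_iff.1 (hs _ h2)
    exact ⟨z, by rw [hz, sub_self]; exact Submodule.zero_mem _⟩
  refine h1.insert_zero (by simpa using hst.symm) ?_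
  rintro w ⟨v, hv⟩
  rw [← insert_empty_eq] at hv
  obtain ⟨y, hy⟩ := exists_sub_X_smul_mem_vectorIdeal hv
  rw [h0, sub_eq_zero] at hy
  have h2 := congrArg F.aug hy
  rw [map_sub, aug_eq_zero_iff.2 ⟨v, rfl⟩, map_smul, map_smul, zero_sub, ← smul_neg] at h2
  obtain ⟨x, hx⟩ := ht (- F.aug w) (F.aug y) (by rw [h2])
  obtain ⟨u, rfl⟩ := F.aug_surjective x
  obtain ⟨z, hz⟩ := aug_eq_zero_iff.1 (show F.aug (w + (X s : MvPolynomial σ k) • u) = 0 by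
    rw [map_add, map_smul, ← hx, add_neg_cancel])
  refine ⟨z, ?_⟩
  rw [hz, sub_add_cancel_left]
  exact Submodule.neg_mem _ (X_smul_mem_vectorIdeal (Set.mem_singleton s) u)

lemma exists_homogeneous_quotient {i n : ℕ} {J : Set σ} {t : σ} {e : Fin (F.rank i) → ℕ}
    {u : Fin (F.rank i) → MvPolynomial σ k} (hu : IsHomogeneousVector e u (n + 1))
    (h : u ∈ vectorIdeal k _ (insert t J)) :
    ∃ w, IsHomogeneousVector e w n ∧ u - (X t : MvPolynomial σ k) • w ∈ vectorIdeal k _ J := by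
  obtain ⟨w, hw⟩ := exists_sub_X_smul_mem_vectorIdeal h
  refine ⟨vectorComponent e n w, isHomogeneousVector_vectorComponent e n w, ?_⟩
  have := vectorComponent_mem_vectorIdeal e (n + 1) hw
  rwa [map_sub, hu.vectorComponent_eq, vectorComponent_X_smul] at this

lemma isHomogeneousVector_diff {i n : ℕ} {v : Fin (F.rank (i + 1)) → MvPolynomial σ k}
    (hv : IsHomogeneousVector (F.deg (i + 1)) v n) :
    IsHomogeneousVector (F.deg i) (F.diff i v) n := by
  rw [isHomogeneousVector_iff, ← map_vectorComponent (F.diff_homogeneous i),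
    hv.vectorComponent_eq]

/-- If the homology of the resolution modulo the variables in `J₀` vanishes in homological degree
`i` and internal degrees above `r + i`, for all `i`, then the same holds modulo the variables in
any larger finite set. -/
lemma exists_sub_diff_mem_of_lt {J₀ : Set σ} {r : ℕ}
    (h₀ : ∀ n > r, ∀ u, IsHomogeneousVector (F.deg 0) u n →
      ∃ z, u - F.diff 0 z ∈ vectorIdeal k _ J₀)
    (hex : F.ExactModulo J₀ 0) (K : Finset σ) :
    (∀ n > r, ∀ u, IsHomogeneousVector (F.deg 0) u n →
      ∃ z, u - F.diff 0 z ∈ vectorIdeal k _ (J₀ ∪ K)) ∧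
    ∀ i, ∀ n > r + (i + 1), ∀ u, IsHomogeneousVector (F.deg (i + 1)) u n →
      F.diff i u ∈ vectorIdeal k _ (J₀ ∪ K) →
      ∃ z, u - F.diff (i + 1) z ∈ vectorIdeal k _ (J₀ ∪ K) := by
  classical
  induction K using Finset.induction_on with
  | empty =>
    rw [Finset.coe_empty, Set.union_empty]
    exact ⟨h₀, fun i n _ u _ hu => hex i (Nat.zero_le i) u hu⟩
  | insert t K _ ih =>
    rw [Finset.coe_insert, Set.union_insert]
    by_cases ht : t ∈ J₀ ∪ K
    · rwa [Set.insert_eq_of_mem ht]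
    refine ⟨fun n hn u hu => ?_, fun i n hn u hu hdu => ?_⟩
    · obtain ⟨z, hz⟩ := ih.1 n hn u hu
      exact ⟨z, vectorIdeal_mono (Set.subset_insert _ _) hz⟩
    · obtain ⟨n, rfl⟩ : ∃ n', n = n' + 1 := ⟨n - 1, by omega⟩
      obtain ⟨w, hwh, hw⟩ := exists_homogeneous_quotient (isHomogeneousVector_diff hu) hdu
      -- The cycle w has both internal and homological degree one less than u, so it is still above
      -- the bound.
      obtain ⟨z, hz⟩ : ∃ z, w - F.diff i z ∈ vectorIdeal k _ (J₀ ∪ K) := by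
        obtain _ | i := i
        · exact ih.1 n (by omega) w hwh
        · exact ih.2 i n (by omega) w hwh (diff_mem_of_sub_X_smul ht hw)
      have hz' : w - F.diff i (vectorComponent (F.deg (i + 1)) n z) ∈ vectorIdeal k _ (J₀ ∪ K) := by
        have := vectorComponent_mem_vectorIdeal (F.deg i) n hz
        rwa [map_sub, hwh.vectorComponent_eq, ← map_vectorComponent (F.diff_homogeneous i)] at this
      set z' := vectorComponent (F.deg (i + 1)) n z
      obtain ⟨y, hy⟩ := ih.2 i (n + 1) hn (u - (X t : MvPolynomial σ k) • z')
        (Submodule.sub_mem (homogeneousVectors (F.deg (i + 1)) (n + 1)) hu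
          ((isHomogeneousVector_vectorComponent _ n z).X_smul t)) (diff_sub_mem hw hz')
      refine ⟨y, ?_⟩
      have := Submodule.add_mem _ (vectorIdeal_mono (Set.subset_insert t (J₀ ∪ K)) hy)
        (X_smul_mem_vectorIdeal (Set.mem_insert t (J₀ ∪ K)) z')
      convert this using 1
      abel

/-- Modulo all variables the differentials vanish by minimality, so no basis vector is a boundary;
the preceding vanishing therefore excludes basis vectors of degree above r+i. -/
lemma deg_le [Finite σ] {J₀ : Set σ} {r : ℕ}
    (h₀ : ∀ n > r, ∀ u, IsHomogeneousVector (F.deg 0) u n →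
      ∃ z, u - F.diff 0 z ∈ vectorIdeal k _ J₀)
    (hex : F.ExactModulo J₀ 0) (i : ℕ) (j : Fin (F.rank i)) : F.deg i j ≤ r + i := by
  classical
  have := Fintype.ofFinite σ
  by_contra! hlt
  have h := exists_sub_diff_mem_of_lt h₀ hex Finset.univ
  rw [Finset.coe_univ, Set.union_univ] at h
  have hrange : ∀ i z, F.diff i z ∈ vectorIdeal k _ Set.univ := by
    intro i z
    rw [pi_eq_sum_univ' z, map_sum]
    refine Submodule.sum_mem _ fun l _ => ?_
    rw [map_smul]
    exact Submodule.smul_mem _ _ (mem_vectorIdeal_univ_iff.2 (F.minimal i l))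
  have hu := isHomogeneousVector_single (k := k) (σ := σ) (F.deg i) j
  obtain ⟨z, hz⟩ : ∃ z, (Pi.single j 1 : Fin (F.rank i) → MvPolynomial σ k) - F.diff i z ∈
      vectorIdeal k _ Set.univ := by
    obtain _ | i := i
    · exact h.1 _ (by omega) _ hu
    · exact h.2 i _ hlt _ hu (hrange _ _)
  have h1 := Submodule.add_mem _ hz (hrange i z)
  rw [sub_add_cancel, mem_vectorIdeal_univ_iff] at h1
  have := h1 j
  simp at this

/-- If all basis elements in homological degree `i` have degree below `e + i`, then the homology
has no socle elements of degree `e`. -/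
lemma exists_sub_diff_mem_of_socle {e : ℕ} (he : ∀ i j, F.deg i j < e + i) (K : Finset σ) (p : ℕ)
    (hex : F.ExactModulo (K : Set σ)ᶜ p) (u : Fin (F.rank p) → MvPolynomial σ k)
    (hu : IsHomogeneousVector (F.deg p) u (e + p))
    (hsoc : ∀ t ∈ K, ∃ z, (X t : MvPolynomial σ k) • u - F.diff p z ∈
      vectorIdeal k _ (K : Set σ)ᶜ) :
    ∃ z, u - F.diff p z ∈ vectorIdeal k _ (K : Set σ)ᶜ := by
  classical
  induction K using Finset.induction_on generalizing p with
  | empty =>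
    refine ⟨0, ?_⟩
    rw [map_zero, sub_zero, Finset.coe_empty, Set.compl_empty]
    exact hu.mem_vectorIdeal_univ (he p)
  | insert t K htK ih =>
    set J : Set σ := (↑(insert t K))ᶜ with hJ
    have htJ : t ∉ J := by simp [hJ]
    have hKJ : (K : Set σ)ᶜ = insert t J := by
      ext s
      by_cases hs : s = t
      · subst hs; simpa using htK
      · simp [hJ, hs]
    rw [hKJ] at ih
    obtain ⟨w, hw⟩ := hsoc t (Finset.mem_insert_self t K)
    have hw' : (X t : MvPolynomial σ k) • u -
        F.diff p (vectorComponent (F.deg (p + 1)) (e + p + 1) w) ∈ vectorIdeal k _ J := by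
      have := vectorComponent_mem_vectorIdeal (F.deg p) (e + p + 1) hw
      rwa [map_sub, vectorComponent_X_smul, hu.vectorComponent_eq,
        ← map_vectorComponent (F.diff_homogeneous p)] at this
    have hwh := isHomogeneousVector_vectorComponent (F.deg (p + 1)) (e + p + 1) w
    set w' := vectorComponent (F.deg (p + 1)) (e + p + 1) w
    -- The connecting map: since X t • u is the boundary of w' modulo J, w' is a cycle modulo
    -- `insert t J`, one homological and one internal degree higher. It is again killed by the
    -- remaining variables.
    obtain ⟨x, hx⟩ := ih (p + 1) (hex.insert_succ htJ) w' hwh (by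
      intro s hs
      obtain ⟨z, hz⟩ := hsoc s (Finset.mem_insert_of_mem hs)
      have hst : F.diff p ((X s : MvPolynomial σ k) • w' - (X t : MvPolynomial σ k) • z) ∈
          vectorIdeal k _ J := by
        have := Submodule.sub_mem _
          (Submodule.smul_mem _ (X t : MvPolynomial σ k) hz)
          (Submodule.smul_mem _ (X s : MvPolynomial σ k) hw')
        convert this using 1
        rw [map_sub, map_smul, map_smul, smul_sub, smul_sub, smul_smul, smul_smul,
          mul_comm (X t : MvPolynomial σ k)]
        abel
      obtain ⟨y, hy⟩ := hex p le_rfl _ hst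
      refine ⟨y, ?_⟩
      have := Submodule.add_mem _ (vectorIdeal_mono (Set.subset_insert t J) hy)
        (X_smul_mem_vectorIdeal (Set.mem_insert t J) z)
      convert this using 1
      abel)
    obtain ⟨y, hy⟩ := exists_sub_X_smul_mem_vectorIdeal hx
    -- As w' is a boundary plus X t • y modulo J, X t • u agrees with X t times the boundary of y,
    -- and X t cancels modulo J.
    refine ⟨y, mem_vectorIdeal_of_X_smul htJ ?_⟩
    have := Submodule.add_mem _ hw' (map_mem_vectorIdeal (F.diff p) hy)
    convert this using 1
    rw [map_sub, map_sub, diff_diff, map_smul, smul_sub]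
    abel

end MinimalGradedFreeResolution

/-! ### Regularity as the top degree modulo a regular sequence of two variables. -/

/-- If `X s, X t` is a regular sequence on `M` and `M / (X s, X t) M` has top degree `r`, then `M`
has regularity `r`. -/
theorem hasRegularity_of_top_degree {k σ M : Type*} [Field k] [Finite σ] [AddCommGroup M]
    [Module k M] [Module (MvPolynomial σ k) M] {ℳ : ℕ → Submodule k M}
    (hℳ : IsIndepGrading (σ := σ) ℳ)
    (hgen : ∃ s : Finset M, (∀ x ∈ s, ∃ n, x ∈ ℳ n) ∧
      Submodule.span (MvPolynomial σ k) (s : Set M) = ⊤)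
    {s t : σ} (hst : s ≠ t) (hs : ∀ x : M, (X s : MvPolynomial σ k) • x = 0 → x = 0)
    (ht : ∀ x y : M, (X t : MvPolynomial σ k) • x = (X s : MvPolynomial σ k) • y →
      ∃ z, x = (X s : MvPolynomial σ k) • z)
    {r : ℕ} (htop : ∀ n > r, ∀ x ∈ ℳ n, ∃ y z,
      x = (X s : MvPolynomial σ k) • y + (X t : MvPolynomial σ k) • z)
    (hne : ∃ x ∈ ℳ r, ∀ y z,
      x ≠ (X s : MvPolynomial σ k) • y + (X t : MvPolynomial σ k) • z) :
    HasRegularity (σ := σ) ℳ r := by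
  classical
  refine ⟨nonempty_minimalGradedFreeResolution hℳ hgen, fun F => ?_⟩
  -- The zeroth homology of F modulo X s and X t is M / (X s, X t) M.
  have hmem : ∀ u : Fin (F.rank 0) → MvPolynomial σ k,
      (∃ z, u - F.diff 0 z ∈ vectorIdeal k _ {t, s}) ↔
        ∃ y z, F.aug u = (X s : MvPolynomial σ k) • y + (X t : MvPolynomial σ k) • z := by
    intro u
    constructor
    · rintro ⟨w, hw⟩
      obtain ⟨z, hz⟩ := exists_sub_X_smul_mem_vectorIdeal hw
      rw [← insert_empty_eq] at hz
      obtain ⟨y, hy⟩ := exists_sub_X_smul_mem_vectorIdeal hz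
      refine ⟨F.aug y, F.aug z, ?_⟩
      have h0 : u - F.diff 0 w - (X t : MvPolynomial σ k) • z - (X s : MvPolynomial σ k) • y = 0 := by
        funext j
        simpa using mem_vectorIdeal.1 hy j
      have h1 := congrArg F.aug h0
      rw [map_sub, map_sub, map_sub, map_smul, map_smul, F.aug_eq_zero_iff.2 ⟨w, rfl⟩, map_zero,
        sub_zero, sub_sub, sub_eq_zero] at h1
      rw [h1, add_comm]
    · rintro ⟨y, z, h⟩
      obtain ⟨y, rfl⟩ := F.aug_surjective y
      obtain ⟨z, rfl⟩ := F.aug_surjective z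
      rw [← map_smul, ← map_smul, ← map_add, ← sub_eq_zero, ← map_sub] at h
      obtain ⟨w, hw⟩ := F.aug_eq_zero_iff.1 h
      refine ⟨w, ?_⟩
      rw [hw, sub_sub_cancel]
      exact Submodule.add_mem _ (X_smul_mem_vectorIdeal (by simp) y)
        (X_smul_mem_vectorIdeal (by simp) z)
  have hex : F.ExactModulo {t, s} 0 := F.exactModulo_pair hst hs ht
  have hle := F.deg_le (J₀ := {t, s}) (r := r) (fun n hn u hu =>
    (hmem u).2 (htop n hn _ (hℳ.map_mem F.aug_homogeneous hu))) hex
  refine ⟨?_, ?_⟩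
  · by_contra hnot
    have hlt : ∀ i j, F.deg i j < r + i := by
      intro i j
      refine lt_of_le_of_ne (hle i j) fun h => hnot ⟨i, j, ?_⟩
      rw [h]
      push_cast
      ring
    obtain ⟨x, hx, hx'⟩ := hne
    obtain ⟨u, rfl⟩ := F.aug_surjective x
    have := Fintype.ofFinite σ
    have hK : ((Finset.univ \ {t, s} : Finset σ) : Set σ)ᶜ = {t, s} := by
      ext a
      simp only [Finset.coe_sdiff, Finset.coe_univ, Finset.coe_insert, Finset.coe_singleton,
        Set.mem_compl_iff, Set.mem_sdiff, Set.mem_univ, true_and, not_not]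
    -- The quotient vanishes in degree r+1, so all its elements of degree r are socle elements.
    have hu := F.exists_sub_diff_mem_of_socle hlt (Finset.univ \ {t, s}) 0 (by rwa [hK])
      (vectorComponent (F.deg 0) r u) (isHomogeneousVector_vectorComponent _ _ _) (by
        intro a _
        rw [hK, hmem]
        refine htop (r + 1) (by omega) _ (hℳ.map_mem F.aug_homogeneous
          ((isHomogeneousVector_vectorComponent _ _ _).X_smul a)))
    rw [hK, hmem, hℳ.map_vectorComponent_eq F.aug_homogeneous hx] at hu
    obtain ⟨y, z, h⟩ := hu
    exact hx' y z h
  · rintro _ ⟨i, j, rfl⟩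
    have := hle i j
    omega

/-! ### The numerical semigroup of x-exponents. -/

namespace MonomialCurve

/-- The hypotheses on the exponent set `Λ = {0} ∪ [a, b] ∪ [c, d]`. -/
structure IsTwoBlock (a b c d : ℕ) (Λ : Finset ℕ) : Prop where
  one_lt : 1 < a
  le : a ≤ b
  lt : b < c
  lt' : c < d
  le_two_mul : c ≤ 2 * a
  two_mul_le : 2 * b ≤ d
  eq : Λ = {0} ∪ Finset.Icc a b ∪ Finset.Icc c d

/-- Membership in the additive semigroup generated by `[a, b] ∪ [c, d]`. -/
def IsExponent (a b c d p : ℕ) : Prop :=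
  (∃ j, j * c ≤ p ∧ p ≤ j * d) ∨ ∃ j, a + j * c ≤ p ∧ p ≤ b + j * d

variable {a b c d : ℕ} {Λ : Finset ℕ}

namespace IsTwoBlock

lemma mem_iff (h : IsTwoBlock a b c d Λ) {α : ℕ} : α ∈ Λ ↔ α = 0 ∨ (a ≤ α ∧ α ≤ b) ∨ (c ≤ α ∧ α ≤ d) := by
  rw [h.eq]
  simp only [Finset.mem_union, Finset.mem_singleton, Finset.mem_Icc]
  tauto

lemma le_of_mem (h : IsTwoBlock a b c d Λ) {α : ℕ} (hα : α ∈ Λ) : α ≤ d := by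
  have := h.lt
  have := h.lt'
  rw [h.mem_iff] at hα
  omega

lemma pos (h : IsTwoBlock a b c d Λ) : 0 < d := by
  have := h.lt'
  omega

lemma zero_mem (h : IsTwoBlock a b c d Λ) : 0 ∈ Λ := h.mem_iff.2 (Or.inl rfl)

lemma d_mem (h : IsTwoBlock a b c d Λ) : d ∈ Λ :=
  h.mem_iff.2 (Or.inr (Or.inr ⟨h.lt'.le, le_rfl⟩))

lemma isExponent_of_mem (h : IsTwoBlock a b c d Λ) {α : ℕ} (hα : α ∈ Λ) :
    IsExponent a b c d α := by
  rcases h.mem_iff.1 hα with h1 | h1 | h1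
  · exact Or.inl ⟨0, by omega, by omega⟩
  · exact Or.inr ⟨0, by omega, by omega⟩
  · exact Or.inl ⟨1, by omega, by omega⟩

lemma isExponent_zero : IsExponent a b c d 0 := Or.inl ⟨0, by omega, by omega⟩

lemma isExponent_add (h : IsTwoBlock a b c d Λ) {p q : ℕ} (hp : IsExponent a b c d p)
    (hq : IsExponent a b c d q) : IsExponent a b c d (p + q) := by
  have := h.le_two_mul
  have := h.two_mul_le
  obtain ⟨i, hi⟩ | ⟨i, hi⟩ := hp <;> obtain ⟨j, hj⟩ | ⟨j, hj⟩ := hq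
  · exact Or.inl ⟨i + j, by rw [add_mul]; omega, by rw [add_mul]; omega⟩
  · exact Or.inr ⟨i + j, by rw [add_mul]; omega, by rw [add_mul]; omega⟩
  · exact Or.inr ⟨i + j, by rw [add_mul]; omega, by rw [add_mul]; omega⟩
  -- Two summands from [a,b] are traded for one from [c,d], by c ≤ 2a and 2b ≤ d.
  · exact Or.inl ⟨i + j + 1, by rw [add_mul, add_mul]; omega, by rw [add_mul, add_mul]; omega⟩

/-- An element `p > n d` of the semigroup with `p ≤ (n + 1) d` lies in one of two intervals. -/
lemma bounds_of_isExponent (h : IsTwoBlock a b c d Λ) {n p : ℕ} (hp : IsExponent a b c d p)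
    (hlt : n * d < p) : n * c + c ≤ p ∨ (a + n * c ≤ p ∧ p ≤ b + n * d) := by
  have := h.le
  have := h.lt
  have := h.lt'
  obtain ⟨j, hj⟩ | ⟨j, hj⟩ := hp
  · have hjn : n < j := by
      by_contra! hle
      have := Nat.mul_le_mul_right d hle
      omega
    have := Nat.mul_le_mul_right c hjn
    rw [Nat.succ_eq_add_one, add_mul] at this
    omega
  · have hjn : n ≤ j := by
      by_contra! hle
      have := Nat.mul_le_mul_right d hle
      rw [Nat.succ_eq_add_one, add_mul] at this
      omega
    rcases hjn.lt_or_eq with hjn | rfl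
    · have := Nat.mul_le_mul_right c hjn
      rw [Nat.succ_eq_add_one, add_mul] at this
      omega
    · exact Or.inr hj

/-- When p > nd, the summand α is the least element of its block for which p-α ≤ nd; what remains is
at least nc, hence in [nc, nd]. Iterating writes p as a sum of n+1 elements of Λ. -/
lemma exists_sub (h : IsTwoBlock a b c d Λ) {n p : ℕ} (hp : IsExponent a b c d p)
    (hle : p ≤ n * d + d) :
    ∃ α ∈ Λ, α ≤ p ∧ IsExponent a b c d (p - α) ∧ p - α ≤ n * d := by
  have := h.le
  have := h.lt
  have := h.lt'
  have hnc : n * c ≤ n * d := Nat.mul_le_mul_left n (by omega)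
  by_cases hpn : p ≤ n * d
  · exact ⟨0, h.zero_mem, by omega, by simpa using hp, by omega⟩
  rcases h.bounds_of_isExponent hp (not_le.1 hpn) with h1 | h1
  · refine ⟨max c (p - n * d), h.mem_iff.2 ?_, ?_, Or.inl ⟨n, ?_, ?_⟩, ?_⟩ <;> omega
  · refine ⟨max a (p - n * d), h.mem_iff.2 ?_, ?_, Or.inl ⟨n, ?_, ?_⟩, ?_⟩ <;> omega

/-- Put m = n-1 ≥ K. Then a+mc ≤ md+1, and c ≤ 2a gives (m+1)c ≤ b+md+1. So [a+mc, b+md] and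
[(m+1)c, (m+1)d] cover every integer in (md, (m+1)d], where p-d lies. -/
lemma isExponent_sub (h : IsTwoBlock a b c d Λ) {K n p : ℕ} (hK : a ≤ K * (d - c) + 1)
    (hn : K + 1 ≤ n) (hlt : n * d < p) (hle : p ≤ n * d + d) :
    d ≤ p ∧ IsExponent a b c d (p - d) := by
  have := h.le
  have := h.lt
  have := h.lt'
  have := h.le_two_mul
  obtain ⟨n, rfl⟩ : ∃ m, n = m + 1 := ⟨n - 1, by omega⟩
  have h1 := Nat.mul_le_mul_right (d - c) (show K ≤ n by omega)
  rw [Nat.mul_sub, Nat.mul_sub] at h1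
  rw [Nat.mul_sub] at hK
  have hnc : n * c ≤ n * d := Nat.mul_le_mul_left n (by omega)
  rw [add_mul, one_mul] at hlt hle
  refine ⟨by omega, ?_⟩
  by_cases hb : p - d ≤ b + n * d
  · exact Or.inr ⟨n, by omega, hb⟩
  · refine Or.inl ⟨n + 1, ?_, ?_⟩ <;> rw [add_mul, one_mul] <;> omega

lemma isExponent_witness (h : IsTwoBlock a b c d Λ) {K : ℕ} (hK : a ≤ K * (d - c) + 1) :
    IsExponent a b c d (K * d + 1) := by
  have := h.one_lt
  have := h.le
  have hnc : K * c ≤ K * d := Nat.mul_le_mul_left K h.lt'.le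
  rw [Nat.mul_sub] at hK
  exact Or.inr ⟨K, by omega, by omega⟩

lemma not_isExponent_witness (h : IsTwoBlock a b c d Λ) {K : ℕ} (hK : K * (d - c) + 1 < a) :
    ¬ IsExponent a b c d (K * d + 1) := by
  intro hp
  have := h.le
  have := h.lt
  have hnc : K * c ≤ K * d := Nat.mul_le_mul_left K h.lt'.le
  rw [Nat.mul_sub] at hK
  have := h.bounds_of_isExponent hp (Nat.lt_succ_self _)
  omega

end IsTwoBlock

/-! ### Monomials of R, the ideals Q and R_+^n, and the reduction number. -/

section CoordRing

variable {k : Type*} [Field k]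

/-- The exponents `(p, q)` of the monomials `x ^ p * y ^ q` in the coordinate ring. -/
def exponents (a b c d : ℕ) : Set (Fin 2 →₀ ℕ) :=
  {m | IsExponent a b c d (m 0) ∧ d ∣ m 0 + m 1}

lemma fin_two_ext {m n : Fin 2 →₀ ℕ} (h0 : m 0 = n 0) (h1 : m 1 = n 1) : m = n := by
  ext i
  fin_cases i
  · exact h0
  · exact h1

lemma monomial_fin_two (m : Fin 2 →₀ ℕ) (r : k) :
    monomial m r = C r * (X 0 ^ m 0 * X 1 ^ m 1) := by
  rw [monomial_eq, Finsupp.prod_fintype _ _ (fun _ => pow_zero _), Fin.prod_univ_two]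

lemma gen_eq_monomial (α : ℕ) :
    gen k d α = monomial (Finsupp.single 0 α + Finsupp.single 1 (d - α)) 1 := by
  simp [monomial_fin_two, gen]

lemma isHomogeneous_gen {α : ℕ} (hα : α ≤ d) : (gen k d α).IsHomogeneous d := by
  rw [gen_eq_monomial]
  refine isHomogeneous_monomial _ ?_
  rw [map_add, Finsupp.degree_single, Finsupp.degree_single]
  omega

lemma IsTwoBlock.add_mem_exponents (h : IsTwoBlock a b c d Λ) {m n : Fin 2 →₀ ℕ}
    (hm : m ∈ exponents a b c d) (hn : n ∈ exponents a b c d) : m + n ∈ exponents a b c d := by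
  refine ⟨h.isExponent_add hm.1 hn.1, ?_⟩
  have := dvd_add hm.2 hn.2
  rwa [add_add_add_comm] at this

/-- The polynomials all of whose monomials have exponents in the semigroup. -/
def monomialSubalgebra (k : Type*) [Field k] (h : IsTwoBlock a b c d Λ) :
    Subalgebra k (MvPolynomial (Fin 2) k) where
  carrier := {f | ∀ m, f.coeff m ≠ 0 → m ∈ exponents a b c d}
  mul_mem' := by
    classical
    intro f g hf hg m hm
    rw [coeff_mul] at hm
    obtain ⟨⟨p, q⟩, hpq, hne⟩ := Finset.exists_ne_zero_of_sum_ne_zero hm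
    rw [Finset.HasAntidiagonal.mem_antidiagonal] at hpq
    rw [← hpq]
    exact h.add_mem_exponents (hf p (left_ne_zero_of_mul hne)) (hg q (right_ne_zero_of_mul hne))
  add_mem' := by
    intro f g hf hg m hm
    rw [coeff_add] at hm
    by_cases h0 : f.coeff m = 0
    · exact hg m (by simpa [h0] using hm)
    · exact hf m h0
  algebraMap_mem' := by
    classical
    intro r m hm
    rw [algebraMap_eq, coeff_C] at hm
    have : m = 0 := by
      by_contra h'
      exact hm (if_neg (Ne.symm h'))
    subst this
    exact ⟨IsTwoBlock.isExponent_zero, by simp⟩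

lemma gen_mem {α : ℕ} (hα : α ∈ Λ) : gen k d α ∈ coordRing k d Λ :=
  Algebra.subset_adjoin (Set.mem_image_of_mem _ hα)

/-- A monomial of the coordinate ring of positive degree is a generator times a monomial of the
coordinate ring. -/
lemma IsTwoBlock.exists_eq_gen_mul (h : IsTwoBlock a b c d Λ) {m : Fin 2 →₀ ℕ}
    (hm : m ∈ exponents a b c d) {n : ℕ} (hn : m 0 + m 1 = (n + 1) * d) :
    ∃ α ∈ Λ, ∃ m' ∈ exponents a b c d, m' 0 + m' 1 = n * d ∧
      ∀ r : k, monomial m r = gen k d α * monomial m' r := by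
  rw [add_mul, one_mul] at hn
  obtain ⟨α, hα, hle, hp, hpn⟩ := h.exists_sub (n := n) hm.1 (by omega)
  have hαd := h.le_of_mem hα
  have hsum : m 0 - α + (m 1 - (d - α)) = n * d := by omega
  refine ⟨α, hα, Finsupp.single 0 (m 0 - α) + Finsupp.single 1 (m 1 - (d - α)), ⟨?_, ?_⟩, ?_, ?_⟩
  · simpa using hp
  · simp [hsum]
  · simpa using hsum
  · intro r
    rw [gen_eq_monomial, monomial_mul, one_mul]
    exact congrArg (fun m => monomial m r) (fin_two_ext (by simp; omega) (by simp; omega))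

lemma IsTwoBlock.monomial_mem (h : IsTwoBlock a b c d Λ) {m : Fin 2 →₀ ℕ}
    (hm : m ∈ exponents a b c d) (r : k) : monomial m r ∈ coordRing k d Λ := by
  obtain ⟨n, hn⟩ := hm.2
  rw [mul_comm] at hn
  induction n generalizing m with
  | zero =>
    have : m = 0 := fin_two_ext (by simp; omega) (by simp; omega)
    rw [this]
    exact Subalgebra.algebraMap_mem _ r
  | succ n ih =>
    obtain ⟨α, hα, m', hm', hn', heq⟩ := h.exists_eq_gen_mul (k := k) hm hn
    rw [heq]
    exact mul_mem (gen_mem hα) (ih hm' hn')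

lemma IsTwoBlock.mem_coordRing_iff (h : IsTwoBlock a b c d Λ) {f : MvPolynomial (Fin 2) k} :
    f ∈ coordRing k d Λ ↔ ∀ m, f.coeff m ≠ 0 → m ∈ exponents a b c d := by
  classical
  constructor
  · have : coordRing k d Λ ≤ monomialSubalgebra k h := by
      refine Algebra.adjoin_le ?_
      rintro _ ⟨α, hα, rfl⟩ m hm
      rw [gen_eq_monomial, coeff_monomial] at hm
      have hm' : Finsupp.single 0 α + Finsupp.single 1 (d - α) = m := by
        by_contra h'
        exact hm (if_neg h')
      have hαd := h.le_of_mem hα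
      rw [← hm']
      refine ⟨?_, ?_⟩
      · simpa using h.isExponent_of_mem hα
      · simp [Nat.add_sub_cancel' hαd]
    exact fun hf => this hf
  · intro hf
    rw [as_sum f]
    exact sum_mem fun m hm => h.monomial_mem (hf m (mem_support_iff.1 hm)) _

/-- Quantifying over y with a prescribed underlying polynomial keeps proofs of membership in R out
of the hypothesis. -/
lemma IsTwoBlock.mem_ideal_of_monomial_mem (h : IsTwoBlock a b c d Λ)
    (I : Ideal (coordRing k d Λ)) (x : coordRing k d Λ)
    (hx : ∀ m, (x : MvPolynomial (Fin 2) k).coeff m ≠ 0 → m ∈ exponents a b c d →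
      ∀ y : coordRing k d Λ,
        (y : MvPolynomial (Fin 2) k) = monomial m ((x : MvPolynomial (Fin 2) k).coeff m) → y ∈ I) :
    x ∈ I := by
  have hmem : ∀ m ∈ (x : MvPolynomial (Fin 2) k).support, m ∈ exponents a b c d := fun m hm =>
    h.mem_coordRing_iff.1 x.2 m (mem_support_iff.1 hm)
  have hsum : x = ∑ m ∈ (x : MvPolynomial (Fin 2) k).support.attach,
      (⟨monomial m.1 ((x : MvPolynomial (Fin 2) k).coeff m.1), h.monomial_mem (hmem _ m.2) _⟩ :
        coordRing k d Λ) := by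
    apply Subtype.ext
    rw [AddSubmonoidClass.coe_finsetSum]
    conv_lhs => rw [as_sum (x : MvPolynomial (Fin 2) k)]
    exact (Finset.sum_attach (x : MvPolynomial (Fin 2) k).support
      (fun m => monomial m ((x : MvPolynomial (Fin 2) k).coeff m))).symm
  rw [hsum]
  exact Ideal.sum_mem _ fun m _ => hx m.1 (mem_support_iff.1 m.2) (hmem _ m.2) _ rfl

/-- The generator `x ^ α * y ^ (d - α)` as an element of the coordinate ring. -/
noncomputable def genElt (k : Type*) [Field k] (d : ℕ) {α : ℕ} (hα : α ∈ Λ) : coordRing k d Λ :=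
  ⟨gen k d α, gen_mem hα⟩

lemma coe_genElt {α : ℕ} (hα : α ∈ Λ) :
    (genElt k d hα : MvPolynomial (Fin 2) k) = gen k d α := rfl

lemma IsTwoBlock.Q_eq (h : IsTwoBlock a b c d Λ) :
    Q k d Λ = Ideal.span {genElt k d h.d_mem, genElt k d h.zero_mem} := by
  unfold Q
  congr 1
  ext f
  simp [Subtype.ext_iff, coe_genElt, gen]

/-- A monomial divisible by `x ^ d` or `y ^ d` within the semigroup is the product of an element
of `Q` and a monomial of the coordinate ring. -/
lemma IsTwoBlock.exists_eq_mul_of_mem_Q (h : IsTwoBlock a b c d Λ) {m : Fin 2 →₀ ℕ}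
    (hm : m ∈ exponents a b c d) (hd : d ≤ m 1 ∨ (d ≤ m 0 ∧ IsExponent a b c d (m 0 - d))) :
    ∃ q ∈ Q k d Λ, ∃ m' ∈ exponents a b c d, m' 0 + m' 1 + d = m 0 + m 1 ∧
      ∀ r : k, monomial m r = (q : MvPolynomial (Fin 2) k) * monomial m' r := by
  rw [h.Q_eq]
  obtain ⟨n, hn⟩ := hm.2
  rcases hd with hd | ⟨hd, hexp⟩
  · refine ⟨genElt k d h.zero_mem, Ideal.subset_span (by simp), m - Finsupp.single 1 d,
      ⟨by simpa using hm.1, ?_⟩, by simp; omega, fun r => ?_⟩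
    · have h1 : m 0 + (m 1 - d) = m 0 + m 1 - d := by omega
      simpa [h1] using Nat.dvd_sub hm.2 (dvd_refl d)
    · rw [coe_genElt, gen_eq_monomial, monomial_mul, one_mul]
      exact congrArg (fun m => monomial m r) (fin_two_ext (by simp) (by simp; omega))
  · refine ⟨genElt k d h.d_mem, Ideal.subset_span (by simp), m - Finsupp.single 0 d,
      ⟨by simpa using hexp, ?_⟩, by simp; omega, fun r => ?_⟩
    · have h1 : m 0 - d + m 1 = m 0 + m 1 - d := by omega
      simpa [h1] using Nat.dvd_sub hm.2 (dvd_refl d)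
    · rw [coe_genElt, gen_eq_monomial, monomial_mul, one_mul]
      exact congrArg (fun m => monomial m r) (fin_two_ext (by simp; omega) (by simp))

lemma IsTwoBlock.mem_Q_iff (h : IsTwoBlock a b c d Λ) {x : coordRing k d Λ} :
    x ∈ Q k d Λ ↔ ∀ m, (x : MvPolynomial (Fin 2) k).coeff m ≠ 0 →
      d ≤ m 1 ∨ (d ≤ m 0 ∧ IsExponent a b c d (m 0 - d)) := by
  classical
  rw [h.Q_eq]
  constructor
  · rw [Ideal.mem_span_pair]
    rintro ⟨y, z, rfl⟩ m hm
    have hcoe : ((y * genElt k d h.d_mem + z * genElt k d h.zero_mem : coordRing k d Λ) :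
        MvPolynomial (Fin 2) k) = (y : MvPolynomial (Fin 2) k) * X 0 ^ d +
          (z : MvPolynomial (Fin 2) k) * X 1 ^ d := by
      simp [coe_genElt, gen]
    rw [hcoe, coeff_add, X_pow_eq_monomial, X_pow_eq_monomial, coeff_mul_monomial',
      coeff_mul_monomial'] at hm
    by_cases h1 : Finsupp.single 1 d ≤ m
    · exact Or.inl (Finsupp.single_le_iff.1 h1)
    by_cases h2 : Finsupp.single 0 d ≤ m
    · refine Or.inr ⟨Finsupp.single_le_iff.1 h2, ?_⟩
      rw [if_pos h2, if_neg h1, add_zero, mul_one] at hm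
      have := (h.mem_coordRing_iff.1 y.2 _ hm).1
      simpa using this
    · rw [if_neg h1, if_neg h2] at hm
      simp at hm
  · intro hx
    refine h.mem_ideal_of_monomial_mem _ _ fun m hm hmexp y hy => ?_
    obtain ⟨q, hq, m', hm', -, heq⟩ := h.exists_eq_mul_of_mem_Q (k := k) hmexp (hx m hm)
    rw [show y = q * ⟨_, h.monomial_mem hm' _⟩ from Subtype.ext (hy.trans (heq _)), ← h.Q_eq]
    exact Ideal.mul_mem_right _ _ hq

lemma degree_fin_two (m : Fin 2 →₀ ℕ) : m.degree = m 0 + m 1 := by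
  rw [Finsupp.degree_eq_sum, Fin.sum_univ_two]

lemma mem_piece_iff {n : ℕ} {x : coordRing k d Λ} :
    x ∈ piece k d Λ n ↔ (x : MvPolynomial (Fin 2) k).IsHomogeneous (n * d) := Iff.rfl

lemma add_eq_of_mem_piece {n : ℕ} {x : coordRing k d Λ} (hx : x ∈ piece k d Λ n)
    {m : Fin 2 →₀ ℕ} (hm : (x : MvPolynomial (Fin 2) k).coeff m ≠ 0) : m 0 + m 1 = n * d := by
  rw [← degree_fin_two]
  by_contra h
  exact hm ((mem_piece_iff.1 hx).coeff_eq_zero h)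

lemma IsTwoBlock.genElt_mem_irrelevant (h : IsTwoBlock a b c d Λ) {α : ℕ} (hα : α ∈ Λ) :
    genElt k d hα ∈ irrelevant k d Λ := by
  refine Ideal.subset_span (Set.mem_iUnion₂.2 ⟨1, Set.mem_Ici.2 le_rfl, ?_⟩)
  rw [SetLike.mem_coe, mem_piece_iff, one_mul]
  exact isHomogeneous_gen (h.le_of_mem hα)

lemma IsTwoBlock.Q_le (h : IsTwoBlock a b c d Λ) : Q k d Λ ≤ irrelevant k d Λ := by
  rw [h.Q_eq, Ideal.span_le, Set.pair_subset_iff]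
  exact ⟨h.genElt_mem_irrelevant _, h.genElt_mem_irrelevant _⟩

/-- The ideal of the coordinate ring spanned by the monomials of degree at least `n`. -/
def degreeGE (k : Type*) [Field k] (d : ℕ) (Λ : Finset ℕ) (n : ℕ) :
    Ideal (coordRing k d Λ) where
  carrier := {x | ∀ m, (x : MvPolynomial (Fin 2) k).coeff m ≠ 0 → n * d ≤ m 0 + m 1}
  zero_mem' := by simp
  add_mem' := by
    intro f g hf hg m hm
    rw [AddMemClass.coe_add, coeff_add] at hm
    by_cases h0 : (f : MvPolynomial (Fin 2) k).coeff m = 0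
    · exact hg m (by simpa [h0] using hm)
    · exact hf m h0
  smul_mem' := by
    classical
    intro f g hg m hm
    rw [smul_eq_mul, MulMemClass.coe_mul, coeff_mul] at hm
    obtain ⟨⟨p, q⟩, hpq, hne⟩ := Finset.exists_ne_zero_of_sum_ne_zero hm
    rw [Finset.HasAntidiagonal.mem_antidiagonal] at hpq
    have := hg q (right_ne_zero_of_mul hne)
    rw [← hpq]
    simp only [Finsupp.add_apply]
    omega

lemma irrelevant_pow_le (n : ℕ) : irrelevant k d Λ ^ n ≤ degreeGE k d Λ n := by
  classical
  induction n with
  | zero =>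
    intro x _ m _
    simp
  | succ n ih =>
    have h1 : irrelevant k d Λ ≤ degreeGE k d Λ 1 := by
      refine Ideal.span_le.2 fun x hx m hm => ?_
      obtain ⟨i, hi, hx⟩ := Set.mem_iUnion₂.1 hx
      rw [add_eq_of_mem_piece hx hm]
      exact Nat.mul_le_mul_right d hi
    rw [pow_succ]
    refine (Ideal.mul_mono ih h1).trans (Ideal.mul_le.2 fun x hx y hy m hm => ?_)
    rw [MulMemClass.coe_mul, coeff_mul] at hm
    obtain ⟨⟨p, q⟩, hpq, hne⟩ := Finset.exists_ne_zero_of_sum_ne_zero hm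
    rw [Finset.HasAntidiagonal.mem_antidiagonal] at hpq
    have hp := hx p (left_ne_zero_of_mul hne)
    have hq := hy q (right_ne_zero_of_mul hne)
    rw [← hpq, add_mul]
    simp only [Finsupp.add_apply] at *
    omega

lemma IsTwoBlock.mem_irrelevant_pow_of_monomial (h : IsTwoBlock a b c d Λ) (n : ℕ)
    {m : Fin 2 →₀ ℕ} (hm : m ∈ exponents a b c d) (hn : n * d ≤ m 0 + m 1) {r : k}
    {y : coordRing k d Λ} (hy : (y : MvPolynomial (Fin 2) k) = monomial m r) :
    y ∈ irrelevant k d Λ ^ n := by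
  induction n generalizing m y with
  | zero => simp
  | succ n ih =>
    obtain ⟨N, hN⟩ := hm.2
    rw [mul_comm] at hN
    rw [hN] at hn
    have hnN := Nat.le_of_mul_le_mul_right hn h.pos
    obtain ⟨N, rfl⟩ : ∃ N', N = N' + 1 := ⟨N - 1, by omega⟩
    obtain ⟨α, hα, m', hm', hn', heq⟩ := h.exists_eq_gen_mul (k := k) hm hN
    have hy' : y = genElt k d hα * ⟨_, h.monomial_mem hm' r⟩ := by
      apply Subtype.ext
      rw [hy, heq]
      rfl
    rw [hy', pow_succ']
    refine Ideal.mul_mem_mul (h.genElt_mem_irrelevant hα) (ih hm' ?_ rfl)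
    rw [hn']
    exact Nat.mul_le_mul_right d (by omega)

/-- In degree N+1, a y-exponent below d forces the x-exponent above Nd, where subtracting d stays in
the semigroup. -/
lemma IsTwoBlock.le_sub_or (h : IsTwoBlock a b c d Λ) {K : ℕ} (hK : a ≤ K * (d - c) + 1)
    {m : Fin 2 →₀ ℕ} (hm : m ∈ exponents a b c d) {n : ℕ} (hn : K + 1 < n)
    (hmn : n * d ≤ m 0 + m 1) : d ≤ m 1 ∨ (d ≤ m 0 ∧ IsExponent a b c d (m 0 - d)) := by
  obtain ⟨N, hN⟩ := hm.2
  rw [mul_comm] at hN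
  rw [hN] at hmn
  have hnN := Nat.le_of_mul_le_mul_right hmn h.pos
  obtain ⟨N, rfl⟩ : ∃ N', N = N' + 1 := ⟨N - 1, by omega⟩
  rw [add_mul, one_mul] at hN
  by_cases hd : d ≤ m 1
  · exact Or.inl hd
  · exact Or.inr (h.isExponent_sub hK (n := N) (by omega) (by omega) (by omega))

lemma IsTwoBlock.mul_pow_eq (h : IsTwoBlock a b c d Λ) {K : ℕ} (hK : a ≤ K * (d - c) + 1)
    {r : ℕ} (hr : K + 1 ≤ r) :
    Q k d Λ * irrelevant k d Λ ^ r = irrelevant k d Λ ^ (r + 1) := by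
  refine le_antisymm ?_ ?_
  · rw [pow_succ']
    exact Ideal.mul_mono_left h.Q_le
  · intro x hx
    have hx' := irrelevant_pow_le _ hx
    refine h.mem_ideal_of_monomial_mem _ _ fun m hm hmexp y hy => ?_
    have hle : (r + 1) * d ≤ m 0 + m 1 := hx' m hm
    have hQ := h.le_sub_or hK hmexp (show K + 1 < r + 1 by omega) hle
    rw [add_mul, one_mul] at hle
    obtain ⟨q, hq, m', hm', hm'm, heq⟩ := h.exists_eq_mul_of_mem_Q (k := k) hmexp hQ
    rw [show y = q * ⟨_, h.monomial_mem hm' _⟩ from Subtype.ext (hy.trans (heq _))]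
    exact Ideal.mul_mem_mul hq (h.mem_irrelevant_pow_of_monomial r hm' (by omega) rfl)

/-- In degree `K + 2` there is a monomial of the coordinate ring outside `(x ^ d, y ^ d)`. -/
lemma IsTwoBlock.exists_notMem_Q (h : IsTwoBlock a b c d Λ) {K : ℕ} (hK : K * (d - c) + 1 < a)
    (hK' : a ≤ (K + 1) * (d - c) + 1) :
    ∃ x ∈ piece k d Λ (K + 2), x ∈ irrelevant k d Λ ^ (K + 2) ∧ x ∉ Q k d Λ := by
  have hd := h.pos
  -- The y-exponent d-1 rules out y^d, and dividing by x^d would leave the x-exponent Kd+1, which is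
  -- a gap of the semigroup.
  set m : Fin 2 →₀ ℕ := Finsupp.single 0 ((K + 1) * d + 1) + Finsupp.single 1 (d - 1) with hm
  have hm0 : m 0 = (K + 1) * d + 1 := by simp [hm]
  have hm1 : m 1 = d - 1 := by simp [hm]
  have hsum : m 0 + m 1 = (K + 2) * d := by
    rw [hm0, hm1, add_mul, add_mul]
    omega
  have hmexp : m ∈ exponents a b c d := by
    refine ⟨?_, by rw [hsum]; exact dvd_mul_left _ _⟩
    rw [hm0]
    exact h.isExponent_witness hK'
  refine ⟨⟨monomial m 1, h.monomial_mem hmexp 1⟩, ?_,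
    h.mem_irrelevant_pow_of_monomial _ hmexp hsum.ge rfl, fun hQ => ?_⟩
  · rw [mem_piece_iff]
    exact isHomogeneous_monomial _ (by rw [degree_fin_two, hsum])
  · rcases h.mem_Q_iff.1 hQ m (by simp) with h1 | h1
    · omega
    · have h2 : m 0 - d = K * d + 1 := by
        rw [hm0, add_mul]
        omega
      rw [h2] at h1
      exact h.not_isExponent_witness hK h1.2

lemma IsTwoBlock.reductionNumber_eq (h : IsTwoBlock a b c d Λ) {K : ℕ}
    (hK : K * (d - c) + 1 < a) (hK' : a ≤ (K + 1) * (d - c) + 1) :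
    reductionNumber (Q k d Λ) (irrelevant k d Λ) = K + 2 := by
  have hset : {r : ℕ | Q k d Λ * irrelevant k d Λ ^ r = irrelevant k d Λ ^ (r + 1)} =
      Set.Ici (K + 2) := by
    ext r
    refine ⟨fun hr => ?_, fun hr => h.mul_pow_eq hK' hr⟩
    by_contra hlt
    have hlt : r < K + 2 := not_le.1 hlt
    obtain ⟨x, _, hx, hxQ⟩ := h.exists_notMem_Q (k := k) hK hK'
    -- An equality at r < K+2 persists after multiplying by powers of R_+, so it would put R_+^(K+2)
    -- inside Q.
    refine hxQ ((Ideal.mul_le_left :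
      Q k d Λ * irrelevant k d Λ ^ (K + 1) ≤ Q k d Λ) ?_)
    have h1 : K + 1 = r + (K + 1 - r) := by omega
    have h2 : K + 2 = r + 1 + (K + 1 - r) := by omega
    have hr : Q k d Λ * irrelevant k d Λ ^ r = irrelevant k d Λ ^ (r + 1) := hr
    rw [h1, pow_add, ← mul_assoc, hr, ← pow_add, ← h2]
    exact hx
  rw [reductionNumber, hset, csInf_Ici]

end CoordRing

end MonomialCurve

/-! ### Coprimality of polynomials in different variables. -/

section Coprime

variable {k σ : Type*} [Field k]

lemma degreeOf_aeval_X_pow (f : Polynomial k) {i j : σ} (hij : i ≠ j) (d : ℕ) :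
    degreeOf j (Polynomial.aeval (X i ^ d : MvPolynomial σ k) f) = 0 := by
  classical
  have hmem : Polynomial.aeval (X i ^ d : MvPolynomial σ k) f ∈ supported k {i} := by
    have h1 : (X i ^ d : MvPolynomial σ k) ∈ supported k {i} :=
      pow_mem (X_mem_supported.2 (Set.mem_singleton i)) d
    rw [Polynomial.aeval_eq_sum_range]
    exact sum_mem fun n _ => Subalgebra.smul_mem _ (pow_mem h1 n) _
  rw [mem_supported] at hmem
  rw [degreeOf_def, Multiset.count_eq_zero]
  intro hj
  exact hij (Set.mem_singleton_iff.1 (hmem (by simpa [vars_def] using hj))).symm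

lemma aeval_X_pow_ne_zero {f : Polynomial k} (hf : f ≠ 0) (i : σ) {d : ℕ} (hd : 0 < d) :
    Polynomial.aeval (X i ^ d : MvPolynomial σ k) f ≠ 0 := by
  intro h
  exact hf (transcendental_iff.1 ((transcendental_X k i).pow hd) f h)

/-- Nonzero polynomials in powers of different variables are relatively prime. -/
lemma isRelPrime_aeval_X_pow {f g : Polynomial k} (hf : f ≠ 0) (hg : g ≠ 0) {i j : σ}
    (hij : i ≠ j) {d : ℕ} (hd : 0 < d) :
    IsRelPrime (Polynomial.aeval (X i ^ d : MvPolynomial σ k) f)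
      (Polynomial.aeval (X j ^ d : MvPolynomial σ k) g) := by
  intro p hpf hpg
  have hF := aeval_X_pow_ne_zero hf i hd
  have hG := aeval_X_pow_ne_zero hg j hd
  obtain ⟨u, hu⟩ := hpf
  obtain ⟨v, hv⟩ := hpg
  have hp : p ≠ 0 := by
    rintro rfl
    exact hF (by rw [hu, zero_mul])
  have hu0 : u ≠ 0 := by
    rintro rfl
    exact hF (by rw [hu, mul_zero])
  have hv0 : v ≠ 0 := by
    rintro rfl
    exact hG (by rw [hv, mul_zero])
  -- Degrees in each variable are additive, and each variable is missing from one of the two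
  -- multiples of p; so p is constant.
  have hdeg : ∀ l, degreeOf l p = 0 := by
    intro l
    by_cases hl : i = l
    · subst hl
      have h1 := degreeOf_aeval_X_pow g hij.symm d
      rw [hv, degreeOf_mul_eq hp hv0] at h1
      omega
    · have h1 := degreeOf_aeval_X_pow f hl d
      rw [hu, degreeOf_mul_eq hp hu0] at h1
      omega
  have hC : p = C (p.coeff 0) := by
    classical
    ext m
    rw [coeff_C]
    split_ifs with h
    · rw [h]
    · by_contra hm
      refine h (Finsupp.ext fun l => ?_).symm
      have := monomial_le_degreeOf l (mem_support_iff.2 hm)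
      rw [hdeg l] at this
      simpa using this
  rw [hC] at hp ⊢
  exact (isUnit_iff_ne_zero.2 fun h => hp (by rw [h, C_0])).map C

end Coprime

/-! ### Regular sequences in R and its presentation. -/

namespace MonomialCurve

variable {a b c d : ℕ} {Λ : Finset ℕ} {k : Type*} [Field k]

lemma mem_exponents_of_add {m : Fin 2 →₀ ℕ}
    (hm : Finsupp.single 1 d + m ∈ exponents a b c d) : m ∈ exponents a b c d := by
  refine ⟨by simpa using hm.1, ?_⟩
  have := hm.2
  simp only [Finsupp.add_apply] at this
  rw [Finsupp.single_eq_of_ne (by decide), Finsupp.single_eq_same] at this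
  refine (Nat.dvd_add_right (dvd_refl d)).1 ?_
  convert this using 1
  ring

/-- Membership in `exponents` is unaffected by adding d to the y-exponent, so multiplying by
polynomials in y^d preserves the span of the monomials outside R. -/
lemma aeval_Y_mul_coeff (g : Polynomial k) (u : MvPolynomial (Fin 2) k)
    (hu : ∀ m, u.coeff m ≠ 0 → m ∉ exponents a b c d) (m : Fin 2 →₀ ℕ)
    (hm : (Polynomial.aeval (X 1 ^ d : MvPolynomial (Fin 2) k) g * u).coeff m ≠ 0) :
    m ∉ exponents a b c d := by
  classical
  have hstep : ∀ n : ℕ, ∀ m, ((X 1 ^ d : MvPolynomial (Fin 2) k) ^ n * u).coeff m ≠ 0 →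
      m ∉ exponents a b c d := by
    intro n
    induction n with
    | zero => simpa using hu
    | succ n ih =>
      intro m hm hmem
      rw [pow_succ', mul_assoc, X_pow_eq_monomial, coeff_monomial_mul', one_mul] at hm
      by_cases hle : Finsupp.single 1 d ≤ m
      · rw [if_pos hle, ← X_pow_eq_monomial] at hm
        refine ih _ hm (mem_exponents_of_add ?_)
        rwa [add_tsub_cancel_of_le hle]
      · exact hm (if_neg hle)
  rw [Polynomial.aeval_eq_sum_range, Finset.sum_mul, coeff_sum] at hm
  obtain ⟨n, _, hn⟩ := Finset.exists_ne_zero_of_sum_ne_zero hm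
  rw [smul_mul_assoc, coeff_smul] at hn
  exact hstep n m (right_ne_zero_of_mul hn)

lemma IsTwoBlock.coe_aeval_genElt (h : IsTwoBlock a b c d Λ) (f : Polynomial k) :
    ((Polynomial.aeval (genElt k d h.d_mem) f : coordRing k d Λ) : MvPolynomial (Fin 2) k) =
      Polynomial.aeval (X 0 ^ d) f ∧
    ((Polynomial.aeval (genElt k d h.zero_mem) f : coordRing k d Λ) : MvPolynomial (Fin 2) k) =
      Polynomial.aeval (X 1 ^ d) f := by
  constructor <;> rw [← Subalgebra.aeval_coe] <;> simp [coe_genElt, gen]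

/-- A polynomial of `k[x, y]` lies in the coordinate ring if some nonzero multiple by a
polynomial in `y ^ d` does. -/
lemma IsTwoBlock.mem_of_aeval_Y_mul_mem (h : IsTwoBlock a b c d Λ) {g : Polynomial k} (hg : g ≠ 0)
    {u : MvPolynomial (Fin 2) k}
    (hu : Polynomial.aeval (X 1 ^ d : MvPolynomial (Fin 2) k) g * u ∈ coordRing k d Λ) :
    u ∈ coordRing k d Λ := by
  classical
  set A := ∑ m ∈ u.support.filter (· ∈ exponents a b c d), monomial m (u.coeff m) with hA
  set B := ∑ m ∈ u.support.filter (· ∉ exponents a b c d), monomial m (u.coeff m) with hB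
  have hAB : A + B = u := by
    rw [hA, hB, Finset.sum_filter_add_sum_filter_not, ← as_sum]
  have hAmem : A ∈ coordRing k d Λ :=
    sum_mem fun m hm => h.monomial_mem (Finset.mem_filter.1 hm).2 _
  have hBsupp : ∀ m, B.coeff m ≠ 0 → m ∉ exponents a b c d := by
    intro m hm
    rw [hB, coeff_sum] at hm
    obtain ⟨n, hn, hne⟩ := Finset.exists_ne_zero_of_sum_ne_zero hm
    rw [coeff_monomial] at hne
    have hnm : n = m := by
      by_contra h'
      exact hne (if_neg h')
    rw [← hnm]
    exact (Finset.mem_filter.1 hn).2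
  have hGB : Polynomial.aeval (X 1 ^ d : MvPolynomial (Fin 2) k) g * B ∈ coordRing k d Λ := by
    have hG : Polynomial.aeval (X 1 ^ d : MvPolynomial (Fin 2) k) g ∈ coordRing k d Λ := by
      rw [← (h.coe_aeval_genElt g).2]
      exact SetLike.coe_mem _
    have := sub_mem hu (mul_mem hG hAmem)
    rwa [← hAB, mul_add, add_sub_cancel_left] at this
  -- All monomials of this product lie both inside and outside the semigroup, so there are none.
  have h0 : Polynomial.aeval (X 1 ^ d : MvPolynomial (Fin 2) k) g * B = 0 := by
    ext m
    by_contra hm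
    exact aeval_Y_mul_coeff g B hBsupp m hm (h.mem_coordRing_iff.1 hGB m hm)
  have hB0 : B = 0 := (mul_eq_zero.1 h0).resolve_left (aeval_X_pow_ne_zero hg 1 h.pos)
  rw [← hAB, hB0, add_zero]
  exact hAmem

/-- Nonzero polynomials in `x ^ d` and `y ^ d` form a regular sequence on the coordinate ring. -/
lemma IsTwoBlock.exists_eq_mul_of_mul_eq (h : IsTwoBlock a b c d Λ) {f g : Polynomial k}
    (hf : f ≠ 0) (hg : g ≠ 0) {u v : coordRing k d Λ}
    (huv : Polynomial.aeval (genElt k d h.zero_mem) g * u =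
      Polynomial.aeval (genElt k d h.d_mem) f * v) :
    ∃ w, u = Polynomial.aeval (genElt k d h.d_mem) f * w := by
  have huv' := congrArg (Subtype.val) huv
  rw [MulMemClass.coe_mul, MulMemClass.coe_mul, (h.coe_aeval_genElt f).1,
    (h.coe_aeval_genElt g).2] at huv'
  -- Divisibility is obtained in the factorial ring k[x,y]; the quotient w lies in R because its
  -- multiple by g(y^d) is v.
  have hdvd : Polynomial.aeval (X 0 ^ d : MvPolynomial (Fin 2) k) f ∣
      (u : MvPolynomial (Fin 2) k) :=
    (isRelPrime_aeval_X_pow hf hg (by decide) h.pos).dvd_of_dvd_mul_left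
      ⟨(v : MvPolynomial (Fin 2) k), huv'⟩
  obtain ⟨w, hw⟩ := hdvd
  rw [hw, mul_left_comm] at huv'
  have hwv := mul_left_cancel₀ (aeval_X_pow_ne_zero hf 0 h.pos) huv'
  refine ⟨⟨w, h.mem_of_aeval_Y_mul_mem hg (by rw [hwv]; exact v.2)⟩, Subtype.ext ?_⟩
  rw [hw, MulMemClass.coe_mul, (h.coe_aeval_genElt f).1]

lemma presentation_surjective :
    Function.Surjective (presentation k d Λ) := by
  have : ∀ x (hx : x ∈ Algebra.adjoin k (gen k d '' (Λ : Set ℕ))),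
      ∃ p, presentation k d Λ p = ⟨x, hx⟩ := by
    intro x hx
    induction hx using Algebra.adjoin_induction with
    | mem x hx =>
      obtain ⟨α, hα, rfl⟩ := hx
      exact ⟨X ⟨α, hα⟩, by simp [presentation]⟩
    | algebraMap r => exact ⟨C r, by simp [presentation]; rfl⟩
    | add x y _ _ hx hy =>
      obtain ⟨p, hp⟩ := hx
      obtain ⟨q, hq⟩ := hy
      exact ⟨p + q, by rw [map_add, hp, hq]; rfl⟩
    | mul x y _ _ hx hy =>
      obtain ⟨p, hp⟩ := hx
      obtain ⟨q, hq⟩ := hy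
      exact ⟨p * q, by rw [map_mul, hp, hq]; rfl⟩
  exact fun x => this x.1 x.2

lemma presentation_X (α : Λ) : presentation k d Λ (X α) = genElt k d α.2 := by
  simp [presentation, genElt]

instance : Algebra.FiniteType k (coordRing k d Λ) :=
  Algebra.FiniteType.of_surjective (presentation k d Λ) presentation_surjective

lemma IsTwoBlock.genElt_pow (h : IsTwoBlock a b c d Λ) {α : ℕ} (hα : α ∈ Λ) :
    genElt k d hα ^ d = genElt k d h.d_mem ^ α * genElt k d h.zero_mem ^ (d - α) := by
  apply Subtype.ext
  simp [coe_genElt, gen, mul_pow, ← pow_mul, mul_comm]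

end MonomialCurve

/-! ### A Cohen-Macaulay criterion for affine domains. -/

section CohenMacaulay

variable {k A : Type*} [Field k] [CommRing A] [Algebra k A]

lemma isIntegral_mk_of_aeval_mem {I : Ideal A} {x : A} {f : Polynomial k} (hf : f ≠ 0)
    (hfI : Polynomial.aeval x f ∈ I) : IsIntegral k (Ideal.Quotient.mkₐ k I x) := by
  refine IsAlgebraic.isIntegral ⟨f, hf, ?_⟩
  rw [Polynomial.aeval_algHom_apply]
  exact Ideal.Quotient.eq_zero_iff_mem.2 hfI

/-- The quotient is integral and of finite type over k, hence Artinian. The bound is an inequality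
because I may be the unit ideal. -/
lemma ringKrullDim_quotient_le_zero {σ : Type*} [Finite σ] {φ : MvPolynomial σ k →ₐ[k] A}
    (hφ : Function.Surjective φ) (I : Ideal A)
    (hint : ∀ i, IsIntegral k (Ideal.Quotient.mkₐ k I (φ (X i)))) :
    ringKrullDim (A ⧸ I) ≤ 0 := by
  have : Algebra.FiniteType k A := .of_surjective φ hφ
  have : Algebra.IsIntegral k (A ⧸ I) := by
    refine ⟨fun y => ?_⟩
    obtain ⟨x, rfl⟩ := Ideal.Quotient.mkₐ_surjective k I y
    obtain ⟨p, rfl⟩ := hφ x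
    induction p using MvPolynomial.induction_on with
    | C r =>
      rw [← algebraMap_eq, AlgHom.commutes, AlgHom.commutes]
      exact isIntegral_algebraMap
    | add p q hp hq =>
      rw [map_add, map_add]
      exact hp.add hq
    | mul_X p i hp =>
      rw [map_mul, map_mul]
      exact hp.mul (hint i)
  have : Module.Finite k (A ⧸ I) := Algebra.IsIntegral.finite
  have : IsArtinianRing (A ⧸ I) := IsArtinianRing.of_finite k _
  have := (Ring.krullDimLE_iff (R := A ⧸ I) (n := 0)).1 inferInstance
  exact_mod_cast this

/-- By Zariski's lemma the residue field is finite over k, so the image of x is algebraic. -/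
lemma exists_aeval_mem_of_isMaximal [Algebra.FiniteType k A] (m : Ideal A) [m.IsMaximal] (x : A) :
    ∃ f : Polynomial k, f ≠ 0 ∧ Polynomial.aeval x f ∈ m := by
  let := Ideal.Quotient.field m
  have : Module.Finite k (A ⧸ m) := finite_of_finite_type_of_isJacobsonRing _ _
  obtain ⟨f, hf, h0⟩ := Algebra.IsAlgebraic.isAlgebraic (R := k) (Ideal.Quotient.mkₐ k m x)
  refine ⟨f, hf, ?_⟩
  rw [Polynomial.aeval_algHom_apply] at h0
  exact Ideal.Quotient.eq_zero_iff_mem.1 h0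

lemma isWeaklyRegular_pair {A : Type*} [CommRing A] [IsDomain A] {x y : A} (hx : x ≠ 0)
    (hxy : ∀ u v, y * u = x * v → ∃ w, u = x * w) :
    RingTheory.Sequence.IsWeaklyRegular A [x, y] := by
  refine .cons (fun u v huv => mul_left_cancel₀ hx huv) (.cons ?_ (.nil _ _))
  rw [isSMulRegular_iff_right_eq_zero_of_smul]
  intro z hz
  obtain ⟨u, rfl⟩ := Submodule.Quotient.mk_surjective _ z
  rw [← Submodule.Quotient.mk_smul, Submodule.Quotient.mk_eq_zero,
    Submodule.mem_smul_pointwise_iff_exists] at hz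
  obtain ⟨v, -, hv⟩ := hz
  obtain ⟨w, rfl⟩ := hxy u v hv.symm
  rw [Submodule.Quotient.mk_eq_zero, Submodule.mem_smul_pointwise_iff_exists]
  exact ⟨w, trivial, rfl⟩

/-- In a Noetherian local ring whose dimension is at most the length of some regular sequence,
depth and dimension agree. -/
lemma localDepth_eq_ringKrullDim {A : Type*} [CommRing A] [IsLocalRing A] [IsNoetherianRing A]
    {rs : List A} (hrs : RingTheory.Sequence.IsRegular A rs)
    (hmem : ∀ t ∈ rs, t ∈ IsLocalRing.maximalIdeal A) (hdim : ringKrullDim A ≤ rs.length) :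
    ((localDepth A : ℕ∞) : WithBot ℕ∞) = ringKrullDim A := by
  have hle : ∀ l : List A, RingTheory.Sequence.IsRegular A l →
      (l.length : WithBot ℕ∞) ≤ ringKrullDim A := by
    intro l hl
    have hnt : Nontrivial (A ⧸ Ideal.ofList l) := by
      have := hl.quot_ofList_smul_nontrivial ⊤
      rwa [smul_eq_mul, Ideal.mul_top] at this
    rw [← ringKrullDim_add_length_eq_ringKrullDim_of_isRegular l hl]
    exact le_add_of_nonneg_left ringKrullDim_nonneg_of_nontrivial
  have heq : ringKrullDim A = rs.length := le_antisymm hdim (hle rs hrs)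
  have hdepth : localDepth A = rs.length := by
    refine le_antisymm (iSup_le fun l => ?_)
      (le_iSup_of_le ⟨rs, hmem, hrs⟩ le_rfl)
    have := hle l.1 l.2.2
    rw [heq] at this
    exact_mod_cast this
  rw [hdepth, heq]
  rfl

/-- A finitely generated domain over a field with two elements `x, y` such that any nonzero
polynomials in `x` and in `y` form a regular sequence with zero-dimensional quotient is
Cohen-Macaulay. -/
theorem isCohenMacaulayRing_of_pair [IsDomain A] [Algebra.FiniteType k A] (x y : A)
    (hx : ∀ f : Polynomial k, f ≠ 0 → Polynomial.aeval x f ≠ 0)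
    (hxy : ∀ f g : Polynomial k, f ≠ 0 → g ≠ 0 → ∀ u v,
      Polynomial.aeval y g * u = Polynomial.aeval x f * v → ∃ w, u = Polynomial.aeval x f * w)
    (hdim : ∀ (I : Ideal A) (f g : Polynomial k), f ≠ 0 → g ≠ 0 → Polynomial.aeval x f ∈ I →
      Polynomial.aeval y g ∈ I → ringKrullDim (A ⧸ I) ≤ 0) :
    IsCohenMacaulayRing A := by
  have hN : IsNoetherianRing A := Algebra.FiniteType.isNoetherianRing k _
  refine ⟨hN, fun m _ => ?_⟩
  obtain ⟨f, hf, hfm⟩ := exists_aeval_mem_of_isMaximal (k := k) m x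
  obtain ⟨g, hg, hgm⟩ := exists_aeval_mem_of_isMaximal (k := k) m y
  have hmem : ∀ t ∈ [Polynomial.aeval x f, Polynomial.aeval y g], t ∈ m := by
    simp [hfm, hgm]
  -- Both elements lie in m, so weak regularity becomes regularity after localizing.
  have hreg := (isWeaklyRegular_pair (hx f hf) (hxy f g hf hg)).isRegular_of_isLocalization_of_mem
    (Localization.AtPrime m) m hmem
  have : IsNoetherianRing (Localization.AtPrime m) :=
    IsLocalization.isNoetherianRing m.primeCompl _ hN
  refine localDepth_eq_ringKrullDim hreg ?_ ?_
  · intro t ht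
    obtain ⟨s, hs, rfl⟩ := List.mem_map.1 ht
    exact (IsLocalization.AtPrime.to_map_mem_maximal_iff _ m s).2 (hmem s hs)
  · set S : Set A := {Polynomial.aeval x f, Polynomial.aeval y g} with hS
    have hdimS := hdim (Ideal.span S) f g hf hg (Ideal.subset_span (by simp [hS]))
      (Ideal.subset_span (by simp [hS]))
    rw [IsLocalization.AtPrime.ringKrullDim_eq_height m]
    refine (Ideal.height_le_ringKrullDim_quotient_add_encard S ?_).trans ?_
    · rintro s (rfl | rfl)
      · exact hfm
      · exact hgm
    · have hcard : S.encard ≤ 2 := Set.encard_insert_le _ _ |>.trans (by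
        rw [Set.encard_singleton]; rfl)
      have hcard' : ((S.encard : ℕ∞) : WithBot ℕ∞) ≤ ((2 : ℕ∞) : WithBot ℕ∞) :=
        WithBot.coe_le_coe.2 hcard
      refine (add_le_add hdimS hcard').trans ?_
      rw [zero_add]
      rfl

end CohenMacaulay

/-! ### R is Cohen-Macaulay. -/

namespace MonomialCurve

variable {a b c d : ℕ} {Λ : Finset ℕ} {k : Type*} [Field k]

theorem IsTwoBlock.isCohenMacaulayRing (h : IsTwoBlock a b c d Λ) :
    IsCohenMacaulayRing (coordRing k d Λ) := by
  refine isCohenMacaulayRing_of_pair (k := k) (genElt k d h.d_mem) (genElt k d h.zero_mem)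
    (fun f hf h0 => ?_) (fun f g hf hg u v => h.exists_eq_mul_of_mul_eq hf hg)
    (fun I f g hf hg hfI hgI => ?_)
  · refine aeval_X_pow_ne_zero (k := k) hf (0 : Fin 2) h.pos ?_
    rw [← (h.coe_aeval_genElt f).1, h0]
    rfl
  · refine ringKrullDim_quotient_le_zero (presentation_surjective (k := k) (d := d) (Λ := Λ)) I
      fun α => ?_
    -- The d-th power of a generator is a monomial in x^d and y^d, which are integral modulo I.
    refine IsIntegral.of_pow h.pos ?_
    rw [presentation_X, ← map_pow, h.genElt_pow, map_mul, map_pow, map_pow]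
    exact ((isIntegral_mk_of_aeval_mem hf hfI).pow _).mul
      ((isIntegral_mk_of_aeval_mem hg hgI).pow _)

end MonomialCurve

/-! ### The regularity of R. -/

namespace MonomialCurve

variable {a b c d : ℕ} {Λ : Finset ℕ} {k : Type*} [Field k]

theorem IsTwoBlock.hasReg (h : IsTwoBlock a b c d Λ) {K : ℕ}
    (hK : K * (d - c) + 1 < a) (hK' : a ≤ (K + 1) * (d - c) + 1) :
    HasReg k d Λ ((K + 2 : ℕ) : ℤ) := by
  let : Module (MvPolynomial Λ k) (coordRing k d Λ) :=
    Module.compHom (coordRing k d Λ) (presentation k d Λ).toRingHom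
  have hsmul : ∀ (p : MvPolynomial Λ k) (x : coordRing k d Λ),
      p • x = presentation k d Λ p * x := fun _ _ => rfl
  have hX : ∀ (α : Λ) (x : coordRing k d Λ),
      (X α : MvPolynomial Λ k) • x = genElt k d α.2 * x := fun α x => by
    rw [hsmul, presentation_X]
  have hmemQ : ∀ x : coordRing k d Λ, x ∈ Q k d Λ ↔ ∃ y z,
      x = (X ⟨d, h.d_mem⟩ : MvPolynomial Λ k) • y + (X ⟨0, h.zero_mem⟩ : MvPolynomial Λ k) • z := by
    intro x
    rw [h.Q_eq, Ideal.mem_span_pair]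
    simp_rw [hX, mul_comm (genElt k d _), eq_comm (a := x)]
  have hd : (⟨d, h.d_mem⟩ : Λ) ≠ ⟨0, h.zero_mem⟩ := by
    intro heq
    exact h.pos.ne' (Subtype.ext_iff.1 heq)
  refine hasRegularity_of_top_degree (s := (⟨d, h.d_mem⟩ : Λ)) (t := ⟨0, h.zero_mem⟩) ?_ ?_ hd
    ?_ ?_ ?_ ?_
  · refine ⟨fun {m n f x} hf hx => ?_, fun s x hx hs n hn => ?_⟩
    · rw [mem_piece_iff, hsmul, MulMemClass.coe_mul, add_mul]
      refine IsHomogeneous.mul ?_ (mem_piece_iff.1 hx)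
      have h1 : ((presentation k d Λ f : coordRing k d Λ) : MvPolynomial (Fin 2) k) =
          aeval (fun α : Λ => gen k d α) f := by
        have := comp_aeval_apply (fun α : Λ => genElt k d α.2) (coordRing k d Λ).val f
        exact this
      rw [h1, mul_comm m d]
      exact hf.aeval _ (fun α => isHomogeneous_gen (h.le_of_mem α.2))
    · have h1 := congrArg (fun y : coordRing k d Λ =>
        homogeneousComponent (n * d) (y : MvPolynomial (Fin 2) k)) hs
      simp only [AddSubmonoidClass.coe_finsetSum, map_sum, ZeroMemClass.coe_zero, map_zero] at h1
      rw [Finset.sum_eq_single_of_mem n hn] at h1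
      · rw [homogeneousComponent_of_mem (mem_piece_iff.1 (hx n)), if_pos rfl] at h1
        exact Subtype.ext h1
      · intro i _ hi
        rw [homogeneousComponent_of_mem (mem_piece_iff.1 (hx i)), if_neg]
        exact fun heq => hi (Nat.eq_of_mul_eq_mul_right h.pos heq).symm
  · refine ⟨{1}, fun x hx => ⟨0, ?_⟩, ?_⟩
    · rw [Finset.mem_singleton.1 hx, mem_piece_iff, zero_mul]
      exact isHomogeneous_one _ _
    · rw [eq_top_iff]
      intro x _
      obtain ⟨p, rfl⟩ := presentation_surjective x
      rw [← mul_one (presentation k d Λ p), ← hsmul]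
      exact Submodule.smul_mem _ _ (Submodule.subset_span (by simp))
  · intro x hx
    rw [hX, mul_eq_zero] at hx
    refine hx.resolve_left fun h0 => ?_
    have := congrArg Subtype.val h0
    simp [coe_genElt, gen] at this
  · intro x y hxy
    simp_rw [hX] at hxy ⊢
    -- Taking f and g to be the variable gives the sequence x^d, y^d itself.
    simpa using h.exists_eq_mul_of_mul_eq (f := Polynomial.X) (g := Polynomial.X)
      Polynomial.X_ne_zero Polynomial.X_ne_zero (u := x) (v := y) (by simpa using hxy)
  · intro n hn x hx
    rw [← hmemQ, h.mem_Q_iff]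
    intro m hm
    exact h.le_sub_or hK' (h.mem_coordRing_iff.1 x.2 m hm) hn (add_eq_of_mem_piece hx hm).ge
  · obtain ⟨x, hx, -, hxQ⟩ := h.exists_notMem_Q (k := k) hK hK'
    exact ⟨x, hx, fun y z heq => hxQ ((hmemQ x).2 ⟨y, z, heq⟩)⟩

end MonomialCurve

/-! ### Assembly and the ceiling formula. -/

theorem mainTheorem2 {k : Type*} [Field k] (a b c d : ℕ)
    (ha : 1 < a) (hab : a ≤ b) (hbc : b < c) (hcd : c < d) (hca : c ≤ 2 * a) (hbd : 2 * b ≤ d)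
    (Λ : Finset ℕ) (hΛ : Λ = {0} ∪ Finset.Icc a b ∪ Finset.Icc c d) :
    IsCohenMacaulayRing (MonomialCurve.coordRing k d Λ) ∧
    IsReduction (MonomialCurve.Q k d Λ) (MonomialCurve.irrelevant k d Λ) ∧
    MonomialCurve.HasReg k d Λ
      (reductionNumber (MonomialCurve.Q k d Λ) (MonomialCurve.irrelevant k d Λ)) ∧
    (reductionNumber (MonomialCurve.Q k d Λ) (MonomialCurve.irrelevant k d Λ) : ℤ) =
      ⌈((a : ℚ) - 1) / ((d : ℚ) - c)⌉ + 1 := by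
  have h : MonomialCurve.IsTwoBlock a b c d Λ := ⟨ha, hab, hbc, hcd, hca, hbd, hΛ⟩
  obtain ⟨K, hK, hK'⟩ : ∃ K, K * (d - c) + 1 < a ∧ a ≤ (K + 1) * (d - c) + 1 := by
    -- For integers, the ceiling of (a-1)/(d-c) is one more than the floor of (a-2)/(d-c), and a ≥ 2
    -- makes the subtraction exact.
    refine ⟨(a - 2) / (d - c), ?_, ?_⟩
    · have := Nat.div_mul_le_self (a - 2) (d - c)
      omega
    · have := Nat.lt_div_mul_add (a := a - 2) (show 0 < d - c by omega)
      rw [add_mul]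
      omega
  have hred := h.reductionNumber_eq (k := k) hK hK'
  refine ⟨h.isCohenMacaulayRing, ⟨h.Q_le, K + 2, h.mul_pow_eq hK' (by omega)⟩, ?_, ?_⟩
  · rw [hred]
    exact h.hasReg hK hK'
  · have hpos : (0 : ℚ) < (d : ℚ) - c := by
      rw [sub_pos]
      exact_mod_cast hcd
    have hceil : ⌈((a : ℚ) - 1) / ((d : ℚ) - c)⌉ = (K : ℤ) + 1 := by
      rw [Int.ceil_eq_iff]
      have h1 : ((K * (d - c) + 1 : ℕ) : ℚ) < a := by exact_mod_cast hK
      have h2 : (a : ℚ) ≤ (((K + 1) * (d - c) + 1 : ℕ) : ℚ) := by exact_mod_cast hK'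
      push_cast [Nat.cast_sub hcd.le] at h1 h2 ⊢
      constructor
      · rw [lt_div_iff₀ hpos]
        linarith
      · rw [div_le_iff₀ hpos]
        linarith
    rw [hred, hceil]
    push_cast
    ring
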